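/- \textbf{Model.} Let $G=(U,V,E)$ be a finite bipartite graph with offline nodes $U$ and online nodes $V$, where $V=V_P\sqcup V_A$ is split into predicted nodes $V_P$ and adversarial nodes $V_A$. Let $H=G[U\cup V_P]$ be the predicted graph. A randomized semi-online matching algorithm is given $H$ in advance. Afterwards the nodes of $V$ arrive one at a time, in an arbitrary order. When a node arrives, the algorithm sees its set of neighbours in $U$, and must irrevocably match it to a neighbour that is still unmatched, or abandon it. $G$, $V_A$ and the arrival order are fixed before the random choices of the algorithm are made. Write $\nu(\cdot)$ for the size of a maximum matching and $\Gamma(\cdot)$ for the set of neighbours in $H$. \textbf{Structured Sampling.} Suppose $\nu(H)=|V_P|$. A matching skeleton of $H$ consists of a partition of $V_P$ into sets $S_0,\dots,S_m$, a partition of $U$ into nonempty sets $T_0,\dots,T_m$ (there are no parts at all if $U=\emptyset$), and a fractional matching $x$ in $H$ such that \begin{itemize} \item $\Gamma(\bigcup_{i<j}S_i)=\bigcup_{i<j}T_i$ for all $0\le j\le m$; \item $|S_i|/|T_i|>|S_j|/|T_j|$ for all $i<j$; \item $x_{vu}=0$ unless $v\in S_i$ and $u\in T_i$ for some common $i$;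 every $v \in V_P$ has fractional degree $1$, and every $u\in T_i$ has fractional degree $|S_i|/|T_i|$. \end{itemize} (The last set $S_m$ may be empty, and then $T_m$ consists of the isolated offline nodes.) A dependent rounding of the component $(S_i,T_i)$ is a random matching $M_i$ in $H$ of size $|S_i|$ between $S_i$ and $T_i$ that contains each edge $(v,u)$, $v\in S_i$, $u\in T_i$, with probability $x_{vu}$; in particular each $u\in T_i$ is matched with probability $|S_i|/|T_i|$. Structured Sampling takes a matching skeleton of $H$, samples dependent roundings $M_i$ of its components independently, sets $M=\bigcup_i M_i$, and takes a uniformly random ordering $R$ of the reserved nodes, i.e. of the offline nodes that $M$ leaves unmatched. When a node $v$ arrives, it is recognized as a predicted node if some predicted node with the same neighbourhood has not been seen yet; in this case it is identified with such a node and matched to $M(v)$. Otherwise $v$ is matched to its first unmatched neighbour in $R$, if there is one (RANKING). \textbf{Theorem.} There is a randomized semi-online bipartite matching algorithm that is Structured Sampling, for some choice of matching skeletons and dependent roundings, on every predicted graph $H$ with $\nu(H)=|V_P|$; in particular such skeletons and roundings always exist. Moreover, every such algorithm has expected competitive ratio at least $1-\delta+\delta^2(1-1/e)$ when $G$ has a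 perfect matching. That is, for every $G$ with a perfect matching, every set $V_P \subseteq V$ and every arrival order, the expected size of the matching that it builds is at least $$\Bigl(1-\delta+\delta^2\bigl(1-\tfrac1e\bigr)\Bigr)\,\nu(G),\qquad \delta=\frac{d}{n},\quad n=|U|=|V|\ge 1,\quad d=|V_A|.$$ -/

import Mathlib

open scoped ENNReal

universe u

/-! Bipartite graphs. A bipartite graph with offline nodes `U` and online nodes `V` is given by the
neighbourhoods `G v : Finset U` of its online nodes. -/

namespace SemiOnline

section Graphs

variable {U V : Type*}

/-- A set of edges `(v, u)` of the bipartite graph `G`, no two of which share an endpoint. -/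
def IsMatching (G : V → Finset U) (M : Finset (V × U)) : Prop :=
  (∀ e ∈ M, e.2 ∈ G e.1) ∧
  (∀ e ∈ M, ∀ f ∈ M, e.1 = f.1 → e = f) ∧
  (∀ e ∈ M, ∀ f ∈ M, e.2 = f.2 → e = f)

/-- The size `ν(G)` of a maximum matching of `G`. -/
noncomputable def matchingNumber [Fintype U] [Fintype V] (G : V → Finset U) : ℕ :=
  open Classical in (Finset.univ.filter fun M => IsMatching G M).sup Finset.card

/-- `G` has a matching that covers every node, online and offline. -/
def HasPerfectMatching (G : V → Finset U) : Prop :=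
  ∃ M : Finset (V × U), IsMatching G M ∧ (∀ v, ∃ u, (v, u) ∈ M) ∧ (∀ u, ∃ v, (v, u) ∈ M)

end Graphs

/-! The semi-online model. -/

section Model

/-- A deterministic online strategy: when an online node with neighbourhood `N` is revealed, after
nodes with neighbourhoods `past` (in order of arrival), the node is matched to `u` if
`σ past N = some u`, and abandoned if `σ past N = none`. The strategy sees nothing but the
neighbourhoods of the nodes that have arrived; in particular it is not told whether a node is
predicted or adversarial. -/
def OnlineStrategy (U : Type*) : Type _ :=
  List (Finset U) → Finset U → Option U

namespace OnlineStrategy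

variable {U : Type*}

/-- The decision on the `i`-th node, when nodes with neighbourhoods `l` arrive one by one. -/
def choice (σ : OnlineStrategy U) (l : List (Finset U)) (i : Fin l.length) : Option U :=
  σ (l.take i) (l.get i)

/-- On every input the decisions form a matching: a node is matched only to a neighbour that no
earlier node was matched to. -/
def Feasible (σ : OnlineStrategy U) : Prop :=
  ∀ (l : List (Finset U)) (i : Fin l.length) (u : U), σ.choice l i = some u →
    u ∈ l.get i ∧ ∀ j < i, σ.choice l j ≠ some u

/-- The number of online nodes that are matched. -/
def size (σ : OnlineStrategy U) (l : List (Finset U)) : ℕ :=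
  (Finset.univ.filter fun i => (σ.choice l i).isSome = true).card

end OnlineStrategy

/-- The expected size of the matching built by a random online strategy with law `p`, when nodes
with neighbourhoods `l` arrive one by one. -/
noncomputable def expectedSize {U : Type*} (p : PMF (OnlineStrategy U)) (l : List (Finset U)) : ℝ :=
  ∑' σ, (p σ).toReal * (σ.size l : ℝ)

/-- A randomized semi-online matching algorithm: given the offline nodes `U` and the predicted graph
`H`, whose online side is the set `P` of predicted nodes, it draws at random a feasible strategy for
the online phase. -/
structure SemiOnlineAlgorithm where
  law : ∀ (U P : Type u) [Fintype U] [DecidableEq U] [Fintype P] [DecidableEq P]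
    (_ : P → Finset U), PMF (OnlineStrategy U)
  feasible : ∀ (U P : Type u) [Fintype U] [DecidableEq U] [Fintype P] [DecidableEq P]
    (H : P → Finset U), ∀ σ ∈ (law U P H).support, σ.Feasible

end Model

/-! Structured Sampling. -/

section StructuredSampling

variable {U P : Type*} [Fintype U] [DecidableEq U] [Fintype P] [DecidableEq P]

/-- Values in `[0, 1]` on the edges of `H`, with fractional degree at most `1` at every node (and
the value `0` outside the edges). -/
structure IsFractionalMatching (H : P → Finset U) (x : P → U → ℝ) : Prop where
  nonneg : ∀ v u, 0 ≤ x v u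
  le_one : ∀ v u, x v u ≤ 1
  support : ∀ v u, u ∉ H v → x v u = 0
  online_degree_le : ∀ v, ∑ u, x v u ≤ 1
  offline_degree_le : ∀ u, ∑ v, x v u ≤ 1

/-- A matching skeleton of `H`: partitions `S 0, …, S (k-1)` of the online side and
`T 0, …, T (k-1)` of the offline side, with a fractional matching `x`. The partitions are given by
the functions that map a node to the index of its part. The sets `T i` are nonempty; `S i` can be
empty (for the last index only), and then `T i` is the set of isolated offline nodes. -/
structure MatchingSkeleton (H : P → Finset U) where
  k : ℕ
  sIndex : P → Fin k
  tIndex : U → Fin k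
  x : P → U → ℝ
  tIndex_surjective : Function.Surjective tIndex
  /-- `Γ(⋃_{i<j} S i) = ⋃_{i<j} T i` -/
  neighbors : ∀ (j : Fin k) (u : U), (∃ v, sIndex v < j ∧ u ∈ H v) ↔ tIndex u < j
  /-- `|S i| / |T i| > |S j| / |T j|` for `i < j` -/
  ratio_strictAnti : StrictAnti fun i : Fin k =>
    ((Finset.univ.filter fun v => sIndex v = i).card : ℝ) /
      ((Finset.univ.filter fun u => tIndex u = i).card : ℝ)
  fractional : IsFractionalMatching H x
  /-- nodes of `S i` are fractionally matched only to nodes of `T i`, and vice versa -/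
  within : ∀ v u, sIndex v ≠ tIndex u → x v u = 0
  online_degree : ∀ v, ∑ u, x v u = 1
  offline_degree : ∀ u, ∑ v, x v u =
    ((Finset.univ.filter fun v => sIndex v = tIndex u).card : ℝ) /
      ((Finset.univ.filter fun u' => tIndex u' = tIndex u).card : ℝ)

namespace MatchingSkeleton

variable {H : P → Finset U}

/-- The part `S i` of the online side. -/
def S (K : MatchingSkeleton H) (i : Fin K.k) : Finset P := Finset.univ.filter fun v => K.sIndex v = i

/-- The part `T i` of the offline side. -/
def T (K : MatchingSkeleton H) (i : Fin K.k) : Finset U := Finset.univ.filter fun u => K.tIndex u = i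

/-- `D` is the law of a random matching obtained from the `i`-th component by dependent rounding: a
matching of size `|S i|` between `S i` and `T i`, which contains each edge `(v, u)` with probability
`x v u`. Hence each node of `T i` is matched with probability `|S i| / |T i|`. -/
def IsRounding (K : MatchingSkeleton H) (i : Fin K.k) (D : PMF (Finset (P × U))) : Prop :=
  (∀ M ∈ D.support, IsMatching H M ∧ M ⊆ K.S i ×ˢ K.T i ∧ M.card = (K.S i).card) ∧
  ∀ v ∈ K.S i, ∀ u ∈ K.T i, D.toOuterMeasure {M | (v, u) ∈ M} = ENNReal.ofReal (K.x v u)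

end MatchingSkeleton

/-- The law of a family of independent random variables with laws `D i`. -/
noncomputable def independentLaw {k : ℕ} {α : Type*} [Fintype α] (D : Fin k → PMF α) :
    PMF (Fin k → α) :=
  PMF.ofFintype (fun f => ∏ i, D i (f i)) (by
    classical
    have h : ∀ i, ∑ a, D i a = 1 := fun i => by
      rw [← tsum_fintype (L := SummationFilter.unconditional _)]
      exact (D i).tsum_coe
    rw [← Fintype.piFinset_univ, ← Finset.prod_univ_sum]
    simp [h])

/-- An online node with neighbourhood `N` is recognized as a predicted node with the same
neighbourhood that has not been seen before, if there is one. -/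
noncomputable def recognize (H : P → Finset U) (seen : Finset P) (N : Finset U) : Option P :=
  (Finset.univ : Finset P).toList.find? fun v => decide (H v = N ∧ v ∉ seen)

/-- The offline node `M(v)` that the matching `M` matches to `v`. -/
noncomputable def partner (M : Finset (P × U)) (v : P) : Option U :=
  (Finset.univ : Finset U).toList.find? fun u => decide ((v, u) ∈ M)

/-- The decision of the online phase on a node with neighbourhood `N`, when the predicted nodes in
`seen` have arrived and the offline nodes in `used` are matched: a predicted node `v` is matched to
`M(v)`, any other node to its first unmatched neighbour in the sequence `R`, if one exists. -/
noncomputable def onlineDecision (H : P → Finset U) (M : Finset (P × U)) (R : List U)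
    (seen : Finset P) (used : Finset U) (N : Finset U) : Option U :=
  match recognize H seen N with
  | some v => partner M v
  | none => R.find? fun u => decide (u ∈ N ∧ u ∉ used)

/-- The sets `seen` and `used` after the nodes with neighbourhoods `past` have arrived. -/
noncomputable def onlineState (H : P → Finset U) (M : Finset (P × U)) (R : List U)
    (past : List (Finset U)) : Finset P × Finset U :=
  past.foldl (fun s N =>
    (s.1 ∪ (recognize H s.1 N).toFinset, s.2 ∪ (onlineDecision H M R s.1 s.2 N).toFinset)) (∅, ∅)

/-- The online phase: predicted nodes follow `M`, all others are matched by RANKING with respect to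
the sequence `R` of reserved offline nodes. -/
noncomputable def onlinePhase (H : P → Finset U) (M : Finset (P × U)) (R : List U) :
    OnlineStrategy U :=
  fun past N =>
    onlineDecision H M R (onlineState H M R past).1 (onlineState H M R past).2 N

/-- The offline nodes that `M` leaves unmatched. -/
def reserved (M : Finset (P × U)) : Finset U :=
  Finset.univ.filter fun u => ∀ v, (v, u) ∉ M

/-- A uniformly random ordering of a finite set of nodes. -/
noncomputable def uniformOrdering (A : Finset U) : PMF (List U) :=
  haveI : Nonempty (Fin A.card ≃ A) := ⟨A.equivFin.symm⟩
  (PMF.uniformOfFintype (Fin A.card ≃ A)).map fun e => List.ofFn fun i => (e i : U)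

/-- Structured Sampling with the matching skeleton `K` and the laws `D i` of random matchings in its
components: sample the matchings `M i` independently, let `M` be their union, and run the online
phase with `M` and a uniformly random ordering of the offline nodes not matched by `M`. -/
noncomputable def structuredSampling {H : P → Finset U} (K : MatchingSkeleton H)
    (D : Fin K.k → PMF (Finset (P × U))) : PMF (OnlineStrategy U) :=
  (independentLaw D).bind fun Mi =>
    let M : Finset (P × U) := Finset.univ.biUnion Mi
    (uniformOrdering (reserved M)).map fun R => onlinePhase H M R

end StructuredSampling

/-- On every predicted graph that has a matching covering all predicted nodes, the algorithm is
Structured Sampling, with some matching skeleton and some dependent rounding of its components. -/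
def SemiOnlineAlgorithm.IsStructuredSampling (alg : SemiOnlineAlgorithm.{u}) : Prop :=
  ∀ (U P : Type u) [Fintype U] [DecidableEq U] [Fintype P] [DecidableEq P] (H : P → Finset U),
    matchingNumber H = Fintype.card P →
    ∃ (K : MatchingSkeleton H) (D : Fin K.k → PMF (Finset (P × U))),
      (∀ i, K.IsRounding i (D i)) ∧ alg.law U P H = structuredSampling K D

/-- The algorithm is feasible by definition; when the realized graph `G` has a perfect matching, its
expected matching size is at least `ρ(δ) * ν(G)`, with `δ = d / n`, for every choice of the set `VP`
of predicted nodes and every order of arrival. The predicted graph is the restriction of `G` to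
`VP`. -/
def SemiOnlineAlgorithm.IsCompetitive (alg : SemiOnlineAlgorithm.{u}) (ρ : ℝ → ℝ) : Prop :=
  ∀ (U V : Type u) [Fintype U] [DecidableEq U] [Fintype V] [DecidableEq V]
    (G : V → Finset U) (VP : Finset V) (order : Fin (Fintype.card V) ≃ V),
    HasPerfectMatching G →
    ρ ((VPᶜ.card : ℝ) / (Fintype.card V : ℝ)) * (matchingNumber G : ℝ) ≤
      expectedSize (alg.law U {v // v ∈ VP} fun v => G v.1) (List.ofFn fun i => G (order i))

end SemiOnline

/-! Let `x` be a fractional assignment of the predicted nodes whose loads (fractional degrees of the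
offline nodes) have the smallest sum of squares. No mass can be moved to a neighbour of smaller
load, so the level sets of the load are the parts of a matching skeleton. Conversely the `x` of any
skeleton uses only neighbours of least load, and this is all that the analysis uses.

An adversarial node taken for a predicted one has the same neighbourhood, so the two can be
exchanged in the analysis, and every predicted node is matched to its partner. Fix mates for the
online nodes. As the mates of the predicted nodes have at least the loads of the nodes that `x`
uses, their total load is at least `∑ v, ∑ u, x v u * load u = ∑ u, load u ^ 2 ≥ |VP| ^ 2 / |U|`
by Cauchy–Schwarz. Of the total load `|VP|` this leaves at most `|VP| - |VP| ^ 2 / |U|` to the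
mates of the adversarial nodes, and a mate is reserved with probability at least one minus its
load. In expectation RANKING matches at least `1 - 1 / e` times as many nodes as there are
adversarial nodes with a reserved mate. This is the primal-dual argument, in a form for
permutations: each matched pair is split between its two nodes according to the position of the
offline node in the ordering, with weights that replace the usual density `e ^ (t - 1)` by its
mean under the order statistics of a uniform sample. -/

namespace SemiOnline

section Weights

open Polynomial

theorem intervalIntegrable_eval_mul_exp (p : ℝ[X]) (a b : ℝ) :
    IntervalIntegrable (fun y => p.eval y * Real.exp (y - 1)) MeasureTheory.volume a b :=
  (p.continuous.mul (by fun_prop)).intervalIntegrable _ _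

/-- The integral over `[0, 1]` against the density `exp (y - 1)`, on polynomials. -/
noncomputable def expIntegral : ℝ[X] →ₗ[ℝ] ℝ where
  toFun p := ∫ y in (0 : ℝ)..1, p.eval y * Real.exp (y - 1)
  map_add' p q := by
    simp only [eval_add, add_mul]
    exact intervalIntegral.integral_add (intervalIntegrable_eval_mul_exp p 0 1)
      (intervalIntegrable_eval_mul_exp q 0 1)
  map_smul' c p := by
    simp only [eval_smul, smul_eq_mul, mul_assoc, RingHom.id_apply]
    exact intervalIntegral.integral_const_mul _ _

theorem expIntegral_apply (p : ℝ[X]) :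
    expIntegral p = ∫ y in (0 : ℝ)..1, p.eval y * Real.exp (y - 1) := rfl

theorem expIntegral_eq_sub_expIntegral_derivative (p : ℝ[X]) :
    expIntegral p = p.eval 1 - p.eval 0 * Real.exp (-1) - expIntegral (derivative p) := by
  have h := intervalIntegral.integral_mul_deriv_eq_deriv_mul (a := 0) (b := 1)
    (u := fun y => p.eval y) (u' := fun y => (derivative p).eval y)
    (v := fun y => Real.exp (y - 1)) (v' := fun y => Real.exp (y - 1))
    (fun y _ => p.hasDerivAt y)
    (fun y _ => by simpa using ((hasDerivAt_id y).sub_const 1).exp)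
    ((derivative p).continuous.intervalIntegrable _ _)
    (Continuous.intervalIntegrable (by fun_prop) _ _)
  simpa [expIntegral_apply] using h

theorem bernsteinPolynomial_eval_nonneg (n i : ℕ) {y : ℝ} (h0 : 0 ≤ y) (h1 : y ≤ 1) :
    0 ≤ (bernsteinPolynomial ℝ n i).eval y := by
  have : 0 ≤ 1 - y := by linarith
  simp only [bernsteinPolynomial, eval_mul, eval_natCast, eval_pow, eval_X, eval_sub, eval_one]
  positivity

theorem expIntegral_bernsteinPolynomial_nonneg (n i : ℕ) :
    0 ≤ expIntegral (bernsteinPolynomial ℝ n i) :=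
  intervalIntegral.integral_nonneg zero_le_one fun _ hy =>
    mul_nonneg (bernsteinPolynomial_eval_nonneg n i hy.1 hy.2) (Real.exp_pos _).le

theorem expIntegral_bernsteinPolynomial_self_le (n : ℕ) :
    expIntegral (bernsteinPolynomial ℝ n n) ≤ 1 / (n + 1) := by
  have hle : expIntegral (bernsteinPolynomial ℝ n n) ≤ ∫ y in (0 : ℝ)..1, y ^ n := by
    refine intervalIntegral.integral_mono_on zero_le_one (intervalIntegrable_eval_mul_exp _ 0 1)
      (Continuous.intervalIntegrable (by fun_prop) _ _) fun y hy => ?_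
    have heval : (bernsteinPolynomial ℝ n n).eval y = y ^ n := by simp [bernsteinPolynomial]
    rw [heval]
    exact mul_le_of_le_one_right (pow_nonneg hy.1 n) (Real.exp_le_one_iff.2 (by linarith [hy.2]))
  simpa [integral_pow] using hle

theorem succ_smul_bernsteinPolynomial {n c : ℕ} (hc : c ≤ n) :
    ((n : ℝ) + 1) • bernsteinPolynomial ℝ n c =
      ((c : ℝ) + 1) • bernsteinPolynomial ℝ (n + 1) (c + 1) +
        ((n : ℝ) + 1 - c) • bernsteinPolynomial ℝ (n + 1) c := by
  have h1 : ((n + 1).choose (c + 1) : ℝ) * (c + 1) = (n + 1) * n.choose c := by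
    exact_mod_cast (Nat.add_one_mul_choose_eq n c).symm
  have h2 : ((n + 1).choose c : ℝ) * (n + 1 - c) = (n + 1) * n.choose c := by
    have := Nat.choose_mul_succ_eq n c
    rw [mul_comm ((n : ℝ) + 1), ← Nat.cast_succ, ← Nat.cast_sub (by omega)]
    exact_mod_cast this.symm
  have h1' := congrArg (C : ℝ → ℝ[X]) h1
  have h2' := congrArg (C : ℝ → ℝ[X]) h2
  simp only [C_mul, C_eq_natCast] at h1' h2'
  simp only [smul_eq_C_mul, bernsteinPolynomial, Nat.add_sub_add_right,
    (by omega : n + 1 - c = (n - c) + 1), pow_succ]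
  linear_combination -(X ^ c * X * (1 - X) ^ (n - c)) * h1' -
    (X ^ c * (1 - X) * (1 - X) ^ (n - c)) * h2'

theorem derivative_bernsteinPolynomial_succ_succ (n i : ℕ) :
    derivative (bernsteinPolynomial ℝ (n + 1) (i + 1)) =
      ((n : ℝ) + 1) • (bernsteinPolynomial ℝ n i - bernsteinPolynomial ℝ n (i + 1)) := by
  simp [bernsteinPolynomial.derivative_succ, smul_eq_C_mul]

theorem derivative_sum_bernsteinPolynomial (n c : ℕ) :
    derivative (∑ i ∈ Finset.range (c + 1), bernsteinPolynomial ℝ (n + 1) i) =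
      -((n : ℝ) + 1) • bernsteinPolynomial ℝ n c := by
  induction c with
  | zero => simp [bernsteinPolynomial.derivative_zero, smul_eq_C_mul]
  | succ c ih =>
    rw [Finset.sum_range_succ, derivative_add, ih, derivative_bernsteinPolynomial_succ_succ]
    module

/-- The expectation of `exp (y - 1)` when `y` is the `i`-th smallest (counted from `0`) of `n + 1`
independent uniform variables on `[0, 1]`. In the primal-dual analysis of RANKING with `n + 1`
offline nodes, it is the share of a matched edge that its offline endpoint receives if it has rank
`i`. -/
noncomputable def rankWeight (n i : ℕ) : ℝ :=
  ((n : ℝ) + 1) * expIntegral (bernsteinPolynomial ℝ n i)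

theorem rankWeight_nonneg (n i : ℕ) : 0 ≤ rankWeight n i :=
  mul_nonneg (by positivity) (expIntegral_bernsteinPolynomial_nonneg n i)

theorem rankWeight_le_succ {n i : ℕ} (h : i < n) : rankWeight n i ≤ rankWeight n (i + 1) := by
  have hparts := expIntegral_eq_sub_expIntegral_derivative (bernsteinPolynomial ℝ (n + 1) (i + 1))
  have hnonneg := expIntegral_bernsteinPolynomial_nonneg (n + 1) (i + 1)
  rw [bernsteinPolynomial.eval_at_1, bernsteinPolynomial.eval_at_0, if_neg (by omega),
    if_neg (by omega), derivative_bernsteinPolynomial_succ_succ, map_smul, map_sub,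
    smul_eq_mul] at hparts
  simp only [rankWeight]
  linarith

theorem rankWeight_mono {n i j : ℕ} (hij : i ≤ j) (hj : j ≤ n) :
    rankWeight n i ≤ rankWeight n j := by
  induction j, hij using Nat.le_induction with
  | base => exact le_rfl
  | succ j _ ih => exact (ih (by omega)).trans (rankWeight_le_succ (by omega))

theorem rankWeight_le_one {n i : ℕ} (h : i ≤ n) : rankWeight n i ≤ 1 := by
  refine (rankWeight_mono h le_rfl).trans ?_
  rw [rankWeight, mul_comm, ← le_div_iff₀ (by positivity)]
  exact expIntegral_bernsteinPolynomial_self_le n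

theorem sum_rankWeight (n : ℕ) :
    ∑ i ∈ Finset.range (n + 1), rankWeight n i = ((n : ℝ) + 1) * (1 - 1 / Real.exp 1) := by
  simp only [rankWeight]
  rw [← Finset.mul_sum, ← map_sum, bernsteinPolynomial.sum,
    expIntegral_eq_sub_expIntegral_derivative]
  simp [Real.exp_neg]

theorem sum_rankWeight_prefix {n c : ℕ} (hc : c < n) :
    ∑ i ∈ Finset.range (c + 1), rankWeight n i =
      (c + 1) * rankWeight n (c + 1) + (n - c) * rankWeight n c - (n + 1) / Real.exp 1 := by
  obtain ⟨n, rfl⟩ : ∃ k, n = k + 1 := ⟨n - 1, by omega⟩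
  have hrec := congrArg expIntegral (succ_smul_bernsteinPolynomial (Nat.le_of_lt_succ hc))
  have hparts := expIntegral_eq_sub_expIntegral_derivative
    (∑ i ∈ Finset.range (c + 1), bernsteinPolynomial ℝ (n + 1) i)
  have heval0 : (∑ i ∈ Finset.range (c + 1), bernsteinPolynomial ℝ (n + 1) i).eval 0 = 1 := by
    simp [eval_finsetSum, bernsteinPolynomial.eval_at_0]
  have heval1 : (∑ i ∈ Finset.range (c + 1), bernsteinPolynomial ℝ (n + 1) i).eval 1 = 0 := by
    simp only [eval_finsetSum, bernsteinPolynomial.eval_at_1]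
    exact Finset.sum_eq_zero fun i hi => if_neg (by rw [Finset.mem_range] at hi; omega)
  rw [derivative_sum_bernsteinPolynomial, heval0, heval1, map_smul, map_sum, Real.exp_neg]
    at hparts
  simp only [map_add, map_smul, smul_eq_mul] at hrec hparts
  simp only [rankWeight, ← Finset.mul_sum, hparts]
  push_cast
  rw [div_eq_mul_inv]
  linear_combination ((n : ℝ) + 1 + 1) * hrec

theorem sum_ite_rankWeight {n c : ℕ} (hc : c < n) :
    ∑ i ∈ Finset.range (n + 1),
      (if i < c + 1 then rankWeight n i + (1 - rankWeight n (c + 1)) else 1 - rankWeight n c) =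
      ((n : ℝ) + 1) * (1 - 1 / Real.exp 1) := by
  have hprefix : {i ∈ Finset.range (n + 1) | i < c + 1} = Finset.range (c + 1) := by
    ext i; simp only [Finset.mem_filter, Finset.mem_range]; omega
  have hcard : {i ∈ Finset.range (n + 1) | ¬ i < c + 1}.card = n - c := by
    rw [Finset.filter_not, hprefix,
      Finset.card_sdiff_of_subset (Finset.range_subset_range.2 (by omega))]
    simp
  rw [Finset.sum_ite, Finset.sum_add_distrib, Finset.sum_const, Finset.sum_const, hprefix, hcard,
    sum_rankWeight_prefix hc, Finset.card_range, nsmul_eq_mul, nsmul_eq_mul, Nat.cast_sub hc.le]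
  push_cast
  ring

theorem one_sub_one_div_exp_one_nonneg : 0 ≤ 1 - 1 / Real.exp 1 := by
  rw [one_div, sub_nonneg]
  exact inv_le_one_of_one_le₀ (Real.one_le_exp zero_le_one)

end Weights

section Orderings

variable {α : Type*}

theorem sum_map_permutations'Aux (f : List α → ℝ) (x : α) (l : List α) :
    ((List.permutations'Aux x l).map f).sum =
      ∑ i ∈ Finset.range (l.length + 1), f (l.insertIdx i x) := by
  induction l generalizing f with
  | nil => simp [List.permutations'Aux]
  | cons a l ih =>
    rw [List.permutations'Aux, List.map_cons, List.sum_cons, List.map_map, ih, List.length_cons,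
      Finset.sum_range_succ' _ (l.length + 1), add_comm]
    simp

theorem sum_map_permutations'_eq_sum_insertIdx [DecidableEq α] (f : List α → ℝ) {x : α}
    {l : List α} (hx : x ∈ l) :
    (l.permutations'.map f).sum = ((l.erase x).permutations'.map fun l' =>
      ∑ i ∈ Finset.range (l'.length + 1), f (l'.insertIdx i x)).sum := by
  rw [((List.perm_cons_erase hx).permutations'.map f).sum_eq, List.permutations']
  generalize (l.erase x).permutations' = L
  induction L with
  | nil => simp
  | cons a L ih => simp [ih, sum_map_permutations'Aux]

theorem length_permutations' (l : List α) : l.permutations'.length = l.length.factorial := by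
  rw [← (List.permutations_perm_permutations' l).length_eq, List.length_permutations]

theorem sum_map_finsetSum {ι : Type*} (L : List α) (W : Finset ι) (F : ι → α → ℝ) :
    (L.map fun a => ∑ w ∈ W, F w a).sum = ∑ w ∈ W, (L.map (F w)).sum := by
  induction L with
  | nil => simp
  | cons a L ih => simp [ih, Finset.sum_add_distrib]

theorem nodup_insertIdx {l : List α} (hl : l.Nodup) {x : α} (hx : x ∉ l) {i : ℕ}
    (hi : i ≤ l.length) : (l.insertIdx i x).Nodup :=
  (List.perm_insertIdx x l hi).nodup_iff.2 (List.nodup_cons.2 ⟨hx, hl⟩)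

theorem idxOf_insertIdx_self [DecidableEq α] {x : α} {l : List α} (hx : x ∉ l) {i : ℕ}
    (hi : i ≤ l.length) : (l.insertIdx i x).idxOf x = i := by
  induction l generalizing i with
  | nil =>
    obtain rfl : i = 0 := by simpa using hi
    simp
  | cons a l ih =>
    rw [List.mem_cons, not_or] at hx
    cases i with
    | zero => simp
    | succ i =>
      rw [List.insertIdx_succ_cons, List.idxOf_cons_ne _ (Ne.symm hx.1),
        ih hx.2 (by simpa using hi)]

theorem idxOf_insertIdx_of_ne [DecidableEq α] {x y : α} (hxy : y ≠ x) {l : List α} {i : ℕ}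
    (hi : i ≤ l.length) :
    (l.insertIdx i x).idxOf y = if l.idxOf y < i then l.idxOf y else l.idxOf y + 1 := by
  induction l generalizing i with
  | nil =>
    obtain rfl : i = 0 := by simpa using hi
    simp [List.idxOf_cons_ne _ hxy.symm]
  | cons a l ih =>
    cases i with
    | zero => simp [List.idxOf_cons_ne _ hxy.symm]
    | succ i =>
      rw [List.insertIdx_succ_cons]
      by_cases ha : a = y
      · simp [ha]
      · rw [List.idxOf_cons_ne _ ha, List.idxOf_cons_ne _ ha, ih (by simpa using hi)]
        split_ifs <;> omega

theorem find?_eq_some_of_sublist {p q : α → Bool} {l' l : List α} (h : l'.Sublist l)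
    (hl : l.Nodup) (hqp : ∀ z ∈ l', q z = true → p z = true) {y : α} (hy : l.find? p = some y)
    (hyl : y ∈ l') (hqy : q y = true) : l'.find? q = some y := by
  induction h with
  | slnil => simp at hyl
  | cons a h ih =>
    rw [List.nodup_cons] at hl
    by_cases ha : p a = true
    · rw [List.find?_cons_of_pos ha, Option.some.injEq] at hy
      exact absurd (hy ▸ h.subset hyl) hl.1
    · rw [List.find?_cons_of_neg ha] at hy
      exact ih hl.2 hqp hy hyl
  | cons_cons a _ ih =>
    rw [List.nodup_cons] at hl
    by_cases ha : p a = true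
    · rw [List.find?_cons_of_pos ha, Option.some.injEq] at hy
      subst hy
      rw [List.find?_cons_of_pos hqy]
    · rw [List.find?_cons_of_neg ha] at hy
      have hqa : ¬ q a = true := fun h' => ha (hqp a (by simp) h')
      rw [List.find?_cons_of_neg hqa]
      have hya : y ≠ a := fun h' => hqa (h' ▸ hqy)
      exact ih hl.2 (fun z hz => hqp z (by simp [hz])) hy (by simpa [hya] using hyl)

theorem idxOf_le_idxOf_of_find?_eq_some [DecidableEq α] {p : α → Bool} {l : List α} {y z : α}
    (hy : l.find? p = some y) (hz : p z = true) : l.idxOf y ≤ l.idxOf z := by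
  induction l with
  | nil => simp at hy
  | cons a l ih =>
    by_cases ha : p a = true
    · rw [List.find?_cons_of_pos ha, Option.some.injEq] at hy
      simp [hy]
    · rw [List.find?_cons_of_neg ha] at hy
      have hay : a ≠ y := fun h => ha (h ▸ List.find?_some hy)
      have haz : a ≠ z := fun h => ha (h ▸ hz)
      rw [List.idxOf_cons_ne _ hay, List.idxOf_cons_ne _ haz]
      exact Nat.succ_le_succ (ih hy)

end Orderings

section Ranking

variable {U : Type*} [DecidableEq U]

/-- The first neighbour in the sequence `R` that is still free. -/
def firstFree (R : List U) (used N : Finset U) : Option U :=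
  R.find? fun u => decide (u ∈ N ∧ u ∉ used)

/-- The offline nodes that RANKING with the sequence `R` has matched after the arrival of the first
`k` online nodes, where the `j`-th online node has the neighbourhood `N j`. -/
def rankingUsed (R : List U) (N : ℕ → Finset U) : ℕ → Finset U
  | 0 => ∅
  | k + 1 => rankingUsed R N k ∪ (firstFree R (rankingUsed R N k) (N k)).toFinset

/-- The offline node to which RANKING matches the `k`-th online node. -/
def rankingMatch (R : List U) (N : ℕ → Finset U) (k : ℕ) : Option U :=
  firstFree R (rankingUsed R N k) (N k)

theorem rankingUsed_succ (R : List U) (N : ℕ → Finset U) (k : ℕ) :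
    rankingUsed R N (k + 1) = rankingUsed R N k ∪ (rankingMatch R N k).toFinset := rfl

theorem mem_of_firstFree_eq_some {R : List U} {used N : Finset U} {y : U}
    (h : firstFree R used N = some y) : y ∈ R ∧ y ∈ N ∧ y ∉ used :=
  ⟨List.mem_of_find?_eq_some h, by simpa using List.find?_some h⟩

theorem exists_firstFree_eq_some {R : List U} {used N : Finset U} {z : U} (hR : z ∈ R)
    (hN : z ∈ N) (hz : z ∉ used) : ∃ y, firstFree R used N = some y ∧ R.idxOf y ≤ R.idxOf z := by
  have h : (firstFree R used N).isSome := List.find?_isSome.2 ⟨z, hR, by simp [hN, hz]⟩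
  obtain ⟨y, hy⟩ := Option.isSome_iff_exists.1 h
  exact ⟨y, hy, idxOf_le_idxOf_of_find?_eq_some hy (by simp [hN, hz])⟩

theorem firstFree_congr {R : List U} {used used' : Finset U} (h : ∀ u ∈ R, u ∈ used ↔ u ∈ used')
    (N : Finset U) : firstFree R used N = firstFree R used' N :=
  List.find?_congr fun u hu => by simp [h u hu]

theorem rankingUsed_mono (R : List U) (N : ℕ → Finset U) : Monotone (rankingUsed R N) :=
  monotone_nat_of_le_succ fun _ => Finset.subset_union_left

theorem mem_rankingUsed_of_rankingMatch_eq_some {R : List U} {N : ℕ → Finset U} {k m : ℕ}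
    (hk : k < m) {y : U} (h : rankingMatch R N k = some y) : y ∈ rankingUsed R N m :=
  rankingUsed_mono R N (Nat.succ_le_of_lt hk) (by simp [rankingUsed_succ, h])

theorem notMem_rankingUsed_of_sublist {R' R : List U} (h : R'.Sublist R) (hR : R.Nodup)
    (N : ℕ → Finset U) (k : ℕ) :
    ∀ z ∈ R', z ∉ rankingUsed R' N k → z ∉ rankingUsed R N k := by
  induction k with
  | zero => simp [rankingUsed]
  | succ k ih =>
    intro z hz hz'
    simp only [rankingUsed_succ, Finset.mem_union, Option.mem_toFinset, Option.mem_def,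
      not_or] at hz' ⊢
    refine ⟨ih z hz hz'.1, fun hm => hz'.2 ?_⟩
    refine find?_eq_some_of_sublist h hR (fun w hw hw' => ?_) hm hz ?_
    · simp only [decide_eq_true_eq] at hw' ⊢
      exact ⟨hw'.1, ih w hw hw'.2⟩
    · simpa using ⟨(mem_of_firstFree_eq_some hm).2.1, hz'.1⟩

theorem exists_rankingMatch_of_sublist {R' R : List U} (h : R'.Sublist R) (hR : R.Nodup)
    {N : ℕ → Finset U} {k : ℕ} {w : U} (hw : rankingMatch R' N k = some w) :
    ∃ y, rankingMatch R N k = some y ∧ R.idxOf y ≤ R.idxOf w :=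
  have ⟨hwR, hwN, hfree⟩ := mem_of_firstFree_eq_some hw
  exists_firstFree_eq_some (h.subset hwR) hwN (notMem_rankingUsed_of_sublist h hR N k w hwR hfree)

theorem firstFree_eq_firstFree_insertIdx {R : List U} {u : U} {i : ℕ}
    (hR : (R.insertIdx i u).Nodup) {used N : Finset U}
    (h : firstFree (R.insertIdx i u) used N ≠ some u) :
    firstFree R used N = firstFree (R.insertIdx i u) used N := by
  cases hy : firstFree (R.insertIdx i u) used N with
  | none =>
    rw [firstFree, List.find?_eq_none] at hy ⊢
    exact fun x hx => hy x (List.subset_insertIdx _ _ _ hx)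
  | some y =>
    obtain ⟨hyi, hyN, hfree⟩ := mem_of_firstFree_eq_some hy
    have hyu : y ≠ u := fun h' => h (h' ▸ hy)
    have hyR : y ∈ R := (List.eq_or_mem_of_mem_insertIdx hyi).resolve_left hyu
    exact find?_eq_some_of_sublist (List.sublist_insertIdx _ _ _) hR (fun _ _ h' => h') hy hyR
      (by simp [hyN, hfree])

theorem rankingUsed_eq_rankingUsed_insertIdx {R : List U} {u : U} {i : ℕ}
    (hR : (R.insertIdx i u).Nodup) {N : ℕ → Finset U} {k : ℕ}
    (hu : u ∉ rankingUsed (R.insertIdx i u) N k) :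
    rankingUsed R N k = rankingUsed (R.insertIdx i u) N k := by
  induction k with
  | zero => rfl
  | succ k ih =>
    simp only [rankingUsed_succ, Finset.mem_union, Option.mem_toFinset, Option.mem_def,
      not_or] at hu ⊢
    rw [ih hu.1, rankingMatch, ih hu.1, firstFree_eq_firstFree_insertIdx hR hu.2]
    rfl

theorem exists_rankingMatch_idxOf_lt_of_notMem_insertIdx {R : List U} {u : U} {i : ℕ}
    (huR : u ∉ R) (hi : i ≤ R.length) (hR : (R.insertIdx i u).Nodup) {N : ℕ → Finset U} {j m : ℕ}
    (hj : j < m) (huN : u ∈ N j) (hu : u ∉ rankingUsed (R.insertIdx i u) N m) :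
    ∃ y, rankingMatch R N j = some y ∧ R.idxOf y < i := by
  have hmem : u ∈ R.insertIdx i u := (List.mem_insertIdx hi).2 (Or.inl rfl)
  have huj : u ∉ rankingUsed (R.insertIdx i u) N j := fun h => hu (rankingUsed_mono _ _ hj.le h)
  obtain ⟨y, hy, hle⟩ := exists_firstFree_eq_some hmem huN huj
  have hyu : y ≠ u := fun h => hu (mem_rankingUsed_of_rankingMatch_eq_some hj (h ▸ hy))
  refine ⟨y, ?_, ?_⟩
  · rw [rankingMatch, rankingUsed_eq_rankingUsed_insertIdx hR huj,
      firstFree_eq_firstFree_insertIdx hR (by simpa [hy] using hyu), hy]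
  · rw [idxOf_insertIdx_self huR hi, idxOf_insertIdx_of_ne hyu hi] at hle
    split_ifs at hle with h
    · exact h
    · omega

/-- The dual value of the offline node `u` after `m` arrivals: its share of the matched edge at
`u`, if there is one. -/
noncomputable def offlineDual (n : ℕ) (R : List U) (N : ℕ → Finset U) (m : ℕ) (u : U) : ℝ :=
  if u ∈ rankingUsed R N m then rankWeight n (R.idxOf u) else 0

/-- The dual value of the `j`-th online node: what its mate leaves of the matched edge. -/
noncomputable def onlineDual (n : ℕ) (R : List U) (N : ℕ → Finset U) (j : ℕ) : ℝ :=
  (rankingMatch R N j).elim 0 fun y => 1 - rankWeight n (R.idxOf y)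

theorem offlineDual_nonneg (n : ℕ) (R : List U) (N : ℕ → Finset U) (m : ℕ) (u : U) :
    0 ≤ offlineDual n R N m u := by
  unfold offlineDual
  split_ifs
  · exact rankWeight_nonneg _ _
  · exact le_rfl

theorem onlineDual_nonneg {n : ℕ} {R : List U} (hR : R.length ≤ n + 1) (N : ℕ → Finset U) (j : ℕ) :
    0 ≤ onlineDual n R N j := by
  unfold onlineDual
  cases h : rankingMatch R N j with
  | none => simp
  | some y =>
    have := List.idxOf_lt_length_iff.2 (mem_of_firstFree_eq_some h).1
    simpa using rankWeight_le_one (n := n) (by omega)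

theorem card_rankingUsed_eq_sum_rankWeight_add_sum_onlineDual (n : ℕ) (R : List U)
    (N : ℕ → Finset U) (m : ℕ) :
    ((rankingUsed R N m).card : ℝ) =
      ∑ u ∈ rankingUsed R N m, rankWeight n (R.idxOf u) +
        ∑ j ∈ Finset.range m, onlineDual n R N j := by
  induction m with
  | zero => simp [rankingUsed]
  | succ m ih =>
    rw [Finset.sum_range_succ, rankingUsed_succ, onlineDual]
    cases h : rankingMatch R N m with
    | none => simpa using ih
    | some y =>
      have hd : Disjoint (rankingUsed R N m) {y} := by
        simpa using (mem_of_firstFree_eq_some h).2.2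
      rw [Option.toFinset_some, Finset.card_union_of_disjoint hd, Finset.sum_union hd]
      push_cast
      rw [ih, Finset.sum_singleton, Finset.card_singleton, Option.elim_some]
      push_cast
      ring

theorem sum_dual_le_card_rankingUsed {n : ℕ} {R : List U} (hR : R.length ≤ n + 1)
    (N : ℕ → Finset U) (m : ℕ) {ι : Type*} (W : Finset ι) {pos : ι → ℕ} {mate : ι → U}
    (hpos : Set.InjOn pos W) (hmate : Set.InjOn mate W) (hm : ∀ w ∈ W, pos w < m) :
    ∑ w ∈ W, (offlineDual n R N m (mate w) + onlineDual n R N (pos w)) ≤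
      ((rankingUsed R N m).card : ℝ) := by
  rw [card_rankingUsed_eq_sum_rankWeight_add_sum_onlineDual n, Finset.sum_add_distrib]
  refine add_le_add ?_ ?_
  · rw [← Finset.sum_image (f := offlineDual n R N m) hmate]
    simp only [offlineDual]
    rw [← Finset.sum_filter]
    exact Finset.sum_le_sum_of_subset_of_nonneg (fun u hu => (Finset.mem_filter.1 hu).2)
      fun _ _ _ => rankWeight_nonneg _ _
  · rw [← Finset.sum_image (f := onlineDual n R N) hpos]
    refine Finset.sum_le_sum_of_subset_of_nonneg (fun j hj => ?_)
      fun _ _ _ => onlineDual_nonneg hR N _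
    obtain ⟨w, hw, rfl⟩ := Finset.mem_image.1 hj
    exact Finset.mem_range.2 (hm w hw)

theorem offlineDual_insertIdx {R : List U} (hR : R.Nodup) {u : U} (huR : u ∉ R)
    {N : ℕ → Finset U} {j m : ℕ} (hj : j < m) (huN : u ∈ N j) {i : ℕ} (hi : i ≤ R.length)
    (hmatch : ∀ y, rankingMatch R N j = some y → i ≤ R.idxOf y) (n : ℕ) :
    offlineDual n (R.insertIdx i u) N m u = rankWeight n i := by
  rw [offlineDual, idxOf_insertIdx_self huR hi, if_pos]
  by_contra hu
  obtain ⟨y, hy, hlt⟩ := exists_rankingMatch_idxOf_lt_of_notMem_insertIdx huR hi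
    (nodup_insertIdx hR huR hi) hj huN hu
  exact hlt.not_ge (hmatch y hy)

theorem le_onlineDual_insertIdx {R : List U} (hR : R.Nodup) {u w : U} (huR : u ∉ R)
    {N : ℕ → Finset U} {j : ℕ} (hw : rankingMatch R N j = some w) {i : ℕ} (hi : i ≤ R.length) :
    1 - rankWeight R.length ((R.insertIdx i u).idxOf w) ≤
      onlineDual R.length (R.insertIdx i u) N j := by
  obtain ⟨y, hy, hle⟩ := exists_rankingMatch_of_sublist (List.sublist_insertIdx R i u)
    (nodup_insertIdx hR huR hi) hw
  rw [onlineDual, hy]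
  refine sub_le_sub_left (rankWeight_mono hle ?_) 1
  have hwR : w ∈ R := (mem_of_firstFree_eq_some hw).1
  have hwu : w ≠ u := fun h => huR (h ▸ hwR)
  have hidx : R.idxOf w < R.length := List.idxOf_lt_length_iff.2 hwR
  rw [idxOf_insertIdx_of_ne hwu hi]
  split_ifs <;> omega

theorem ite_le_dual_insertIdx {R : List U} (hR : R.Nodup) {u w : U} (huR : u ∉ R)
    {N : ℕ → Finset U} {j m : ℕ} (hj : j < m) (huN : u ∈ N j) (hw : rankingMatch R N j = some w)
    {i : ℕ} (hi : i ≤ R.length) :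
    (if i < R.idxOf w + 1 then
        rankWeight R.length i + (1 - rankWeight R.length (R.idxOf w + 1))
      else 1 - rankWeight R.length (R.idxOf w)) ≤
      offlineDual R.length (R.insertIdx i u) N m u +
        onlineDual R.length (R.insertIdx i u) N j := by
  have honline := le_onlineDual_insertIdx hR huR hw hi
  have hwu : w ≠ u := fun h => huR (h ▸ (mem_of_firstFree_eq_some hw).1)
  rw [idxOf_insertIdx_of_ne hwu hi] at honline
  split_ifs with h
  · rw [if_neg (by omega)] at honline
    rw [offlineDual_insertIdx hR huR hj huN hi fun y hy => ?_]
    · linarith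
    · rw [hw, Option.some.injEq] at hy
      subst hy
      omega
  · rw [if_pos (by omega)] at honline
    linarith [offlineDual_nonneg R.length (R.insertIdx i u) N m u]

theorem le_sum_dual_insertIdx {R : List U} (hR : R.Nodup) {u : U} (huR : u ∉ R)
    {N : ℕ → Finset U} {j m : ℕ} (hj : j < m) (huN : u ∈ N j) :
    ((R.length : ℝ) + 1) * (1 - 1 / Real.exp 1) ≤ ∑ i ∈ Finset.range (R.length + 1),
      (offlineDual R.length (R.insertIdx i u) N m u +
        onlineDual R.length (R.insertIdx i u) N j) := by
  have hle : ∀ {i}, i ∈ Finset.range (R.length + 1) → i ≤ R.length := fun hi =>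
    Nat.lt_succ_iff.1 (Finset.mem_range.1 hi)
  cases hw : rankingMatch R N j with
  | none =>
    rw [← sum_rankWeight]
    refine Finset.sum_le_sum fun i hi => ?_
    rw [offlineDual_insertIdx hR huR hj huN (hle hi) (by simp [hw])]
    exact le_add_of_nonneg_right
      (onlineDual_nonneg (List.length_insertIdx_of_le_length (hle hi) u).le N j)
  | some w =>
    rw [← sum_ite_rankWeight (List.idxOf_lt_length_iff.2 (mem_of_firstFree_eq_some hw).1)]
    exact Finset.sum_le_sum fun i hi => ite_le_dual_insertIdx hR huR hj huN hw (hle hi)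

theorem le_sum_permutations'_dual {l : List U} (hl : l.Nodup) {n : ℕ} (hn : l.length = n + 1)
    {u : U} (hu : u ∈ l) {N : ℕ → Finset U} {j m : ℕ} (hj : j < m) (huN : u ∈ N j) :
    (l.length.factorial : ℝ) * (1 - 1 / Real.exp 1) ≤
      (l.permutations'.map fun R => offlineDual n R N m u + onlineDual n R N j).sum := by
  rw [sum_map_permutations'_eq_sum_insertIdx _ hu]
  have hlen : (l.erase u).length = n := by
    rw [List.length_erase_of_mem hu, hn, Nat.add_sub_cancel]
  have hinsert : ∀ R ∈ (l.erase u).permutations', ((n : ℝ) + 1) * (1 - 1 / Real.exp 1) ≤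
      ∑ i ∈ Finset.range (R.length + 1), (offlineDual n (R.insertIdx i u) N m u +
        onlineDual n (R.insertIdx i u) N j) := fun R hR => by
    have hperm := List.mem_permutations'.1 hR
    obtain rfl : R.length = n := hperm.length_eq.trans hlen
    exact le_sum_dual_insertIdx (hperm.nodup_iff.2 (hl.erase _))
      (fun h => (hl.mem_erase_iff.1 (hperm.mem_iff.1 h)).1 rfl) hj huN
  have hsum := List.sum_le_sum hinsert
  rw [List.map_const', List.sum_replicate, length_permutations', hlen, nsmul_eq_mul] at hsum
  refine le_trans (le_of_eq ?_) hsum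
  rw [hn, Nat.factorial_succ]
  push_cast
  ring

theorem le_sum_permutations'_card_rankingUsed {l : List U} (hl : l.Nodup) (N : ℕ → Finset U)
    (m : ℕ) {ι : Type*} (W : Finset ι) {pos : ι → ℕ} {mate : ι → U} (hpos : Set.InjOn pos W)
    (hmate : Set.InjOn mate W) (hm : ∀ w ∈ W, pos w < m) (hN : ∀ w ∈ W, mate w ∈ N (pos w))
    (hmem : ∀ w ∈ W, mate w ∈ l) :
    (l.length.factorial : ℝ) * ((1 - 1 / Real.exp 1) * W.card) ≤
      (l.permutations'.map fun R => ((rankingUsed R N m).card : ℝ)).sum := by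
  rcases W.eq_empty_or_nonempty with rfl | ⟨w₀, hw₀⟩
  · simp only [Finset.card_empty, Nat.cast_zero, mul_zero]
    exact List.sum_nonneg (by simp)
  obtain ⟨n, hn⟩ : ∃ n, l.length = n + 1 :=
    Nat.exists_eq_add_one.2 (List.length_pos_of_mem (hmem w₀ hw₀))
  calc (l.length.factorial : ℝ) * ((1 - 1 / Real.exp 1) * W.card)
      = ∑ _w ∈ W, (l.length.factorial : ℝ) * (1 - 1 / Real.exp 1) := by
        rw [Finset.sum_const, nsmul_eq_mul]
        ring
    _ ≤ ∑ w ∈ W, (l.permutations'.map fun R =>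
          offlineDual n R N m (mate w) + onlineDual n R N (pos w)).sum :=
        Finset.sum_le_sum fun w hw =>
          le_sum_permutations'_dual hl hn (hmem w hw) (hm w hw) (hN w hw)
    _ = (l.permutations'.map fun R => ∑ w ∈ W,
          (offlineDual n R N m (mate w) + onlineDual n R N (pos w))).sum :=
        (sum_map_finsetSum _ _ _).symm
    _ ≤ _ := List.sum_le_sum fun R hR => sum_dual_le_card_rankingUsed
        ((List.mem_permutations'.1 hR).length_eq.trans hn).le N m W hpos hmate hm

theorem rankingUsed_congr (R : List U) {N N' : ℕ → Finset U} {k : ℕ}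
    (h : ∀ j < k, N j = N' j) : rankingUsed R N k = rankingUsed R N' k := by
  induction k with
  | zero => rfl
  | succ k ih => rw [rankingUsed, rankingUsed, ih fun j hj => h j (by omega), h k (by omega)]

/-- The offline nodes that RANKING with the sequence `R` matches when nodes with neighbourhoods `L`
arrive one by one. -/
def ranking (R : List U) (L : List (Finset U)) : Finset U :=
  rankingUsed R (fun j => L.getD j ∅) L.length

theorem ranking_append_singleton (R : List U) (L : List (Finset U)) (N : Finset U) :
    ranking R (L ++ [N]) = ranking R L ∪ (firstFree R (ranking R L) N).toFinset := by
  have hprefix : rankingUsed R (fun j => (L ++ [N]).getD j ∅) L.length = ranking R L :=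
    rankingUsed_congr R fun j hj => List.getD_append _ _ _ _ hj
  rw [ranking, List.length_append, List.length_singleton, rankingUsed, hprefix]
  simp

theorem le_sum_permutations'_card_ranking {V : Type*} {G : V → Finset U} {VA W : Finset V}
    (hW : W ⊆ VA) {L : List (Finset U)} (hL : (L : Multiset (Finset U)) = VA.val.map G)
    {A : List U} (hA : A.Nodup) {mate : V → U} (hmate : Set.InjOn mate W)
    (hG : ∀ v ∈ W, mate v ∈ G v) (hmem : ∀ v ∈ W, mate v ∈ A) :
    (A.length.factorial : ℝ) * ((1 - 1 / Real.exp 1) * W.card) ≤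
      (A.permutations'.map fun R => ((ranking R L).card : ℝ)).sum := by
  classical
  obtain ⟨arrivals, rfl, harrivals⟩ : ∃ l' : List V, L = l'.map G ∧ l'.Perm VA.toList := by
    have hperm : L.Perm (VA.toList.map G) :=
      Multiset.coe_eq_coe.1 (by rw [hL, ← Multiset.map_coe, Finset.coe_toList])
    exact (congrFun₂ (List.eq_map_comp_perm G) L VA.toList).mpr hperm
  have hmem_arrivals : ∀ v ∈ W, v ∈ arrivals := fun v hv =>
    harrivals.mem_iff.2 (Finset.mem_toList.2 (hW hv))
  have hidx : ∀ v ∈ W, arrivals.idxOf v < (arrivals.map G).length := fun v hv => by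
    simpa using List.idxOf_lt_length_iff.2 (hmem_arrivals v hv)
  refine le_sum_permutations'_card_rankingUsed hA _ _ W (pos := arrivals.idxOf)
    (fun v hv w _ h => (List.idxOf_inj (hmem_arrivals v hv)).1 h) hmate hidx (fun v hv => ?_) hmem
  rw [List.getD_eq_getElem _ _ (hidx v hv)]
  simpa using hG v hv

end Ranking

section OnlineStrategy

variable {U : Type*}

theorem OnlineStrategy.size_eq_sum_range (σ : OnlineStrategy U)
    (l : List (Finset U)) :
    σ.size l = ∑ i ∈ Finset.range l.length,
      if (σ (l.take i) (l.getD i ∅)).isSome = true then 1 else 0 := by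
  rw [size, Finset.card_filter, Finset.sum_range]
  refine Finset.sum_congr rfl fun i _ => ?_
  rw [List.getD_eq_getElem _ _ i.2]
  rfl

theorem OnlineStrategy.size_append_singleton (σ : OnlineStrategy U)
    (l : List (Finset U)) (N : Finset U) :
    σ.size (l ++ [N]) = σ.size l + if (σ l N).isSome = true then 1 else 0 := by
  rw [size_eq_sum_range, size_eq_sum_range, List.length_append, List.length_singleton,
    Finset.sum_range_succ]
  congr 1
  · refine Finset.sum_congr rfl fun i hi => ?_
    rw [Finset.mem_range] at hi
    rw [List.take_append_of_le_length hi.le, List.getD_append _ _ _ _ hi]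
  · simp

end OnlineStrategy

section Partner

variable {U P : Type*} [Fintype U] [DecidableEq U] [DecidableEq P] {M : Finset (P × U)} {v : P}

theorem mem_of_partner_eq_some {u : U} (h : partner M v = some u) : (v, u) ∈ M := by
  simpa using List.find?_some h

theorem exists_partner_eq_some (h : ∃ u, (v, u) ∈ M) : ∃ u, partner M v = some u := by
  obtain ⟨u, hu⟩ := h
  exact Option.isSome_iff_exists.1 (List.find?_isSome.2 ⟨u, by simp, by simpa using hu⟩)

end Partner

section OnlinePhase

variable {U P : Type*} [DecidableEq U] [Fintype P] [DecidableEq P] {H : P → Finset U}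
  {M : Finset (P × U)} {R : List U}

theorem recognize_eq_some {seen : Finset P} {N : Finset U} {v : P}
    (h : recognize H seen N = some v) : H v = N ∧ v ∉ seen := by
  simpa using List.find?_some h

theorem recognize_eq_none {seen : Finset P} {N : Finset U} (h : recognize H seen N = none) {v : P}
    (hv : v ∉ seen) : H v ≠ N := by
  rw [recognize, List.find?_eq_none] at h
  intro hN
  exact h v (by simp) (by simp [hN, hv])

/-- The predicted nodes that have been recognized, and the list of the neighbourhoods of the other
nodes, after nodes with neighbourhoods `l` have arrived. -/
noncomputable def recognition (H : P → Finset U) (l : List (Finset U)) :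
    Finset P × List (Finset U) :=
  l.foldl (fun s N =>
    (recognize H s.1 N).elim (s.1, s.2 ++ [N]) fun v => (insert v s.1, s.2)) (∅, [])

theorem recognition_append_singleton (l : List (Finset U)) (N : Finset U) :
    recognition H (l ++ [N]) = (recognize H (recognition H l).1 N).elim
      ((recognition H l).1, (recognition H l).2 ++ [N])
      fun v => (insert v (recognition H l).1, (recognition H l).2) := by
  simp [recognition]

theorem recognition_append_of_eq_some {l : List (Finset U)} {N : Finset U} {v : P}
    (h : recognize H (recognition H l).1 N = some v) :
    recognition H (l ++ [N]) = (insert v (recognition H l).1, (recognition H l).2) := by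
  rw [recognition_append_singleton, h, Option.elim_some]

theorem recognition_append_of_eq_none {l : List (Finset U)} {N : Finset U}
    (h : recognize H (recognition H l).1 N = none) :
    recognition H (l ++ [N]) = ((recognition H l).1, (recognition H l).2 ++ [N]) := by
  rw [recognition_append_singleton, h, Option.elim_none]

theorem map_recognized_add_unrecognized (l : List (Finset U)) :
    (recognition H l).1.val.map H + ((recognition H l).2 : Multiset (Finset U)) = l := by
  induction l using List.reverseRecOn with
  | nil => simp [recognition]
  | append_singleton l N ih =>
    have hl : ((l ++ [N] : List (Finset U)) : Multiset (Finset U)) = N ::ₘ l :=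
      Multiset.coe_eq_coe.2 (List.perm_append_singleton N l)
    cases hr : recognize H (recognition H l).1 N with
    | some v =>
      obtain ⟨hv, hvs⟩ := recognize_eq_some hr
      rw [recognition_append_of_eq_some hr, Finset.insert_val_of_notMem hvs, Multiset.map_cons, hv,
        Multiset.cons_add, ih, hl]
    | none =>
      have hcons : (((recognition H l).2 ++ [N] : List (Finset U)) : Multiset (Finset U)) =
          N ::ₘ (recognition H l).2 := Multiset.coe_eq_coe.2 (List.perm_append_singleton N _)
      rw [recognition_append_of_eq_none hr, hcons, Multiset.add_cons, ih, hl]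

theorem ne_of_mem_unrecognized {l : List (Finset U)} {v : P} (hv : v ∉ (recognition H l).1) :
    H v ∉ (recognition H l).2 := by
  induction l using List.reverseRecOn with
  | nil => simp [recognition]
  | append_singleton l N ih =>
    cases hr : recognize H (recognition H l).1 N with
    | some w =>
      rw [recognition_append_of_eq_some hr] at hv ⊢
      exact ih fun h => hv (Finset.mem_insert_of_mem h)
    | none =>
      rw [recognition_append_of_eq_none hr] at hv ⊢
      rw [List.mem_append, List.mem_singleton, not_or]
      exact ⟨ih hv, recognize_eq_none hr hv⟩

theorem recognized_eq_univ_and_unrecognized_eq {l : List (Finset U)} {B : Multiset (Finset U)}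
    (hl : (l : Multiset (Finset U)) = (Finset.univ : Finset P).val.map H + B) :
    (recognition H l).1 = Finset.univ ∧ ((recognition H l).2 : Multiset (Finset U)) = B := by
  set seen := (recognition H l).1 with hseen
  have hsplit : seen.val.map H + seenᶜ.val.map H = (Finset.univ : Finset P).val.map H := by
    rw [← Multiset.map_add, Finset.compl_eq_univ_sdiff, Finset.sdiff_val,
      add_tsub_cancel_of_le (Finset.val_le_iff.2 (Finset.subset_univ seen))]
  have hunrecognized : ((recognition H l).2 : Multiset (Finset U)) = seenᶜ.val.map H + B := by
    have h := map_recognized_add_unrecognized (H := H) l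
    rw [hl, ← hsplit, ← hseen, add_assoc] at h
    exact add_left_cancel h
  have huniv : seen = Finset.univ := by
    refine Finset.eq_univ_iff_forall.2 fun v => by_contra fun hv => ne_of_mem_unrecognized hv ?_
    rw [← Multiset.mem_coe, hunrecognized, Multiset.mem_add]
    exact Or.inl (Multiset.mem_map_of_mem H (Finset.mem_compl.2 hv))
  exact ⟨huniv, by simpa [huniv] using hunrecognized⟩

variable [Fintype U]

theorem onlineDecision_of_recognize_eq_some {seen : Finset P} {used N : Finset U} {v : P}
    (h : recognize H seen N = some v) : onlineDecision H M R seen used N = partner M v := by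
  simp only [onlineDecision, h]

theorem onlineDecision_of_recognize_eq_none {seen : Finset P} {used N : Finset U}
    (h : recognize H seen N = none) :
    onlineDecision H M R seen used N = firstFree R used N := by
  simp only [onlineDecision, h]
  rfl

theorem onlineState_append_singleton (past : List (Finset U)) (N : Finset U) :
    onlineState H M R (past ++ [N]) =
      ((onlineState H M R past).1 ∪ (recognize H (onlineState H M R past).1 N).toFinset,
        (onlineState H M R past).2 ∪ (onlinePhase H M R past N).toFinset) := by
  simp [onlineState, onlinePhase]

theorem mem_or_exists_of_mem_onlineState (past : List (Finset U)) :
    ∀ u ∈ (onlineState H M R past).2,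
      u ∈ R ∨ ∃ v ∈ (onlineState H M R past).1, (v, u) ∈ M := by
  induction past using List.reverseRecOn with
  | nil => simp [onlineState]
  | append_singleton past N ih =>
    rw [onlineState_append_singleton]
    intro u hu
    rcases Finset.mem_union.1 hu with hu | hu
    · rcases ih u hu with h | ⟨v, hv, h⟩
      · exact Or.inl h
      · exact Or.inr ⟨v, Finset.mem_union_left _ hv, h⟩
    · rw [Option.mem_toFinset, Option.mem_def, onlinePhase] at hu
      cases hr : recognize H (onlineState H M R past).1 N with
      | some v =>
        rw [onlineDecision_of_recognize_eq_some hr] at hu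
        exact Or.inr ⟨v, by simp, mem_of_partner_eq_some hu⟩
      | none =>
        rw [onlineDecision_of_recognize_eq_none hr] at hu
        exact Or.inl (mem_of_firstFree_eq_some hu).1

theorem mem_onlineState_of_choice_eq_some (l : List (Finset U)) (j : Fin l.length) (i : ℕ)
    (hij : (j : ℕ) < i) {u : U} (h : (onlinePhase H M R).choice l j = some u) :
    u ∈ (onlineState H M R (l.take i)).2 := by
  induction i with
  | zero => omega
  | succ i ih =>
    by_cases hi : i < l.length
    · rw [List.take_succ_eq_append_getElem hi, onlineState_append_singleton]
      rcases Nat.lt_succ_iff_lt_or_eq.1 hij with hlt | rfl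
      · exact Finset.mem_union_left _ (ih hlt)
      · refine Finset.mem_union_right _ ?_
        simpa [OnlineStrategy.choice] using h
    · have hmem := ih (by have := j.2; omega)
      rw [List.take_of_length_le (by omega)] at hmem ⊢
      exact hmem

theorem onlinePhase_eq_some (hM : IsMatching H M) (hR : ∀ u ∈ R, ∀ v, (v, u) ∉ M)
    {past : List (Finset U)} {N : Finset U} {u : U} (hu : onlinePhase H M R past N = some u) :
    u ∈ N ∧ u ∉ (onlineState H M R past).2 := by
  rw [onlinePhase] at hu
  cases hr : recognize H (onlineState H M R past).1 N with
  | some v =>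
    rw [onlineDecision_of_recognize_eq_some hr] at hu
    have hvu := mem_of_partner_eq_some hu
    refine ⟨(recognize_eq_some hr).1 ▸ hM.1 _ hvu, fun hused => ?_⟩
    rcases mem_or_exists_of_mem_onlineState _ u hused with h | ⟨w, hw, h⟩
    · exact hR u h v hvu
    · have hvw : v = w := congrArg Prod.fst (hM.2.2 _ hvu _ h rfl)
      exact (recognize_eq_some hr).2 (hvw ▸ hw)
  | none =>
    rw [onlineDecision_of_recognize_eq_none hr] at hu
    exact (mem_of_firstFree_eq_some hu).2

theorem feasible_onlinePhase (hM : IsMatching H M) (hR : ∀ u ∈ R, ∀ v, (v, u) ∉ M) :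
    (onlinePhase H M R).Feasible := fun l i _ hu =>
  have ⟨hN, hfree⟩ := onlinePhase_eq_some hM hR hu
  ⟨hN, fun j hj hju => hfree (mem_onlineState_of_choice_eq_some l j i hj hju)⟩

theorem onlineState_fst (l : List (Finset U)) :
    (onlineState H M R l).1 = (recognition H l).1 := by
  induction l using List.reverseRecOn with
  | nil => rfl
  | append_singleton l N ih =>
    rw [onlineState_append_singleton, ih]
    cases hr : recognize H (recognition H l).1 N with
    | some v =>
      rw [recognition_append_of_eq_some hr, Option.toFinset_some, Finset.union_comm]
      rfl
    | none => rw [recognition_append_of_eq_none hr, Option.toFinset_none, Finset.union_empty]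

theorem onlinePhase_of_recognize_eq_some {l : List (Finset U)} {N : Finset U} {v : P}
    (h : recognize H (recognition H l).1 N = some v) : onlinePhase H M R l N = partner M v :=
  onlineDecision_of_recognize_eq_some (by rwa [onlineState_fst])

theorem onlinePhase_of_recognize_eq_none {l : List (Finset U)} {N : Finset U}
    (h : recognize H (recognition H l).1 N = none) :
    onlinePhase H M R l N = firstFree R (onlineState H M R l).2 N :=
  onlineDecision_of_recognize_eq_none (by rwa [onlineState_fst])

theorem mem_onlineState_iff_mem_ranking (hR : ∀ u ∈ R, ∀ v, (v, u) ∉ M) (l : List (Finset U)) :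
    ∀ u ∈ R, u ∈ (onlineState H M R l).2 ↔ u ∈ ranking R (recognition H l).2 := by
  induction l using List.reverseRecOn with
  | nil => simp [onlineState, recognition, ranking, rankingUsed]
  | append_singleton l N ih =>
    intro u hu
    rw [onlineState_append_singleton]
    cases hr : recognize H (recognition H l).1 N with
    | some v =>
      have hne : partner M v ≠ some u := fun h => hR u hu v (mem_of_partner_eq_some h)
      rw [onlinePhase_of_recognize_eq_some hr, recognition_append_of_eq_some hr]
      simp [ih u hu, hne]
    | none =>
      rw [onlinePhase_of_recognize_eq_none hr, recognition_append_of_eq_none hr,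
        ranking_append_singleton, firstFree_congr ih, Finset.mem_union, Finset.mem_union, ih u hu]

theorem size_onlinePhase (hM : ∀ v, ∃ u, (v, u) ∈ M) (hR : ∀ u ∈ R, ∀ v, (v, u) ∉ M)
    (l : List (Finset U)) :
    (onlinePhase H M R).size l =
      (recognition H l).1.card + (ranking R (recognition H l).2).card := by
  induction l using List.reverseRecOn with
  | nil => rfl
  | append_singleton l N ih =>
    rw [OnlineStrategy.size_append_singleton, ih]
    cases hr : recognize H (recognition H l).1 N with
    | some v =>
      obtain ⟨u, hu⟩ := exists_partner_eq_some (hM v)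
      rw [onlinePhase_of_recognize_eq_some hr, hu, recognition_append_of_eq_some hr,
        Finset.card_insert_of_notMem (recognize_eq_some hr).2, Option.isSome_some, if_pos rfl]
      exact add_right_comm _ _ _
    | none =>
      rw [onlinePhase_of_recognize_eq_none hr, recognition_append_of_eq_none hr,
        ranking_append_singleton, firstFree_congr (mem_onlineState_iff_mem_ranking hR l)]
      cases hy : firstFree R (ranking R (recognition H l).2) N with
      | none => simp
      | some y =>
        rw [Option.toFinset_some, Finset.card_union_of_disjoint
          (by simpa using (mem_of_firstFree_eq_some hy).2.2)]
        simp [add_assoc]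

theorem le_sum_permutations'_size_onlinePhase {V : Type*} {G : V → Finset U} {VA W : Finset V}
    (hW : W ⊆ VA) {l : List (Finset U)}
    (hl : (l : Multiset (Finset U)) = (Finset.univ : Finset P).val.map H + VA.val.map G)
    (hM : ∀ v, ∃ u, (v, u) ∈ M) {A : List U} (hA : A.Nodup) (hAM : ∀ u ∈ A, ∀ v, (v, u) ∉ M)
    {mate : V → U} (hmate : Set.InjOn mate W) (hG : ∀ v ∈ W, mate v ∈ G v)
    (hmem : ∀ v ∈ W, mate v ∈ A) :
    (A.length.factorial : ℝ) * (Fintype.card P + (1 - 1 / Real.exp 1) * W.card) ≤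
      (A.permutations'.map fun R => ((onlinePhase H M R).size l : ℝ)).sum := by
  obtain ⟨hseen, hunrecognized⟩ := recognized_eq_univ_and_unrecognized_eq hl
  have hsize : ∀ R ∈ A.permutations', ((onlinePhase H M R).size l : ℝ) =
      Fintype.card P + ((ranking R (recognition H l).2).card : ℝ) := fun R hR => by
    rw [size_onlinePhase hM
      (fun u hu => hAM u ((List.mem_permutations'.1 hR).mem_iff.1 hu)), hseen, Finset.card_univ]
    push_cast
    rfl
  rw [List.map_congr_left hsize, List.sum_map_add, List.map_const', List.sum_replicate,
    length_permutations', nsmul_eq_mul, mul_add]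
  exact add_le_add le_rfl
    (le_sum_permutations'_card_ranking hW hunrecognized hA hmate hG hmem)

end OnlinePhase

section Load

variable {U P : Type*} [Fintype P]

/-- The fractional degree of the offline node `u` under the assignment `x`. -/
def load (x : P → U → ℝ) (u : U) : ℝ :=
  ∑ v, x v u

@[fun_prop]
theorem continuous_load (u : U) : Continuous fun x : P → U → ℝ => load x u := by
  unfold load
  fun_prop

theorem load_add_single [DecidableEq P] (x : P → U → ℝ) (v : P) (a : U → ℝ) :
    load (x + Pi.single v a) = load x + a := by
  funext u
  simp only [load, Pi.add_apply, Finset.sum_add_distrib, add_right_inj]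
  rw [Finset.sum_eq_single v (fun w _ hw => by simp [hw]) (by simp), Pi.single_eq_same]

end Load

section Skeleton

theorem IsMatching.exists_mem {U P : Type*} {H : P → Finset U} {M : Finset (P × U)}
    (hM : IsMatching H M) {S : Finset P} (hS : ∀ e ∈ M, e.1 ∈ S) (hcard : M.card = S.card) {v : P}
    (hv : v ∈ S) : ∃ u, (v, u) ∈ M := by
  have hsurj := Finset.surj_on_of_inj_on_of_card_le (fun e (_ : e ∈ M) => e.1) hS
    (fun e f he hf => hM.2.1 e he f hf) hcard.ge
  obtain ⟨⟨w, u⟩, he, rfl⟩ := hsurj v hv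
  exact ⟨u, he⟩

theorem exists_antitone_index {U : Type*} [Finite U] (y : U → ℝ) :
    ∃ (k : ℕ) (t : U → Fin k), Function.Surjective t ∧ ∀ u u', t u ≤ t u' ↔ y u' ≤ y u := by
  have := Fintype.ofFinite U
  let Y : Finset ℝ := Finset.univ.image y
  let rank : Y ≃o Fin Y.card := (Y.orderIsoOfFin rfl).symm
  let level : U → Y := fun u => ⟨y u, Finset.mem_image_of_mem y (Finset.mem_univ u)⟩
  have hlevel : Function.Surjective level := fun ⟨c, hc⟩ => by
    obtain ⟨u, -, hu⟩ := Finset.mem_image.1 hc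
    exact ⟨u, Subtype.ext hu⟩
  refine ⟨Y.card, fun u => Fin.rev (rank (level u)),
    Fin.rev_surjective.comp (rank.surjective.comp hlevel), fun u u' => ?_⟩
  rw [Fin.rev_le_rev, rank.le_iff_le]
  rfl

variable {U P : Type*}

theorem exists_injective_of_matchingNumber_eq [Fintype U] [Fintype P] {H : P → Finset U}
    (h : matchingNumber H = Fintype.card P) :
    ∃ m : P → U, Function.Injective m ∧ ∀ v, m v ∈ H v := by
  classical
  obtain ⟨M, hMmem, hcard⟩ := Finset.exists_mem_eq_sup
    (Finset.univ.filter fun M => IsMatching H M) ⟨∅, by simp [IsMatching]⟩ Finset.card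
  have hM : IsMatching H M := (Finset.mem_filter.1 hMmem).2
  choose m hm using fun v => hM.exists_mem (fun e _ => Finset.mem_univ e.1)
    (by rw [← hcard, Finset.card_univ, ← h, matchingNumber]) (Finset.mem_univ v)
  exact ⟨m, fun v w hvw => congrArg Prod.fst (hM.2.2 _ (hm v) _ (hm w) hvw), fun v => hM.1 _ (hm v)⟩

variable [Fintype U] {H : P → Finset U} {x : P → U → ℝ}

/-- The fractional assignments of all online nodes to neighbours. Offline nodes may have fractional
degree greater than `1`. -/
def fractionalAssignments (H : P → Finset U) : Set (P → U → ℝ) :=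
  {x | (∀ v u, 0 ≤ x v u) ∧ (∀ v u, u ∉ H v → x v u = 0) ∧ ∀ v, ∑ u, x v u = 1}

theorem le_one_of_mem_fractionalAssignments (hx : x ∈ fractionalAssignments H) (v : P) (u : U) :
    x v u ≤ 1 :=
  (Finset.single_le_sum (fun w _ => hx.1 v w) (Finset.mem_univ u)).trans_eq (hx.2.2 v)

theorem mem_of_pos_of_mem_fractionalAssignments (hx : x ∈ fractionalAssignments H) {v : P} {u : U}
    (hpos : 0 < x v u) : u ∈ H v :=
  by_contra fun h => hpos.ne' (hx.2.1 v u h)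

theorem exists_pos_of_mem_fractionalAssignments (hx : x ∈ fractionalAssignments H) (v : P) :
    ∃ u, 0 < x v u := by
  have hsum : ∑ _u : U, (0 : ℝ) < ∑ u, x v u := by rw [hx.2.2 v]; simp
  obtain ⟨u, -, hu⟩ := Finset.exists_lt_of_sum_lt hsum
  exact ⟨u, hu⟩

theorem isCompact_fractionalAssignments (H : P → Finset U) :
    IsCompact (fractionalAssignments H) := by
  have hclosed : IsClosed (fractionalAssignments H) := by
    simp only [fractionalAssignments, Set.ofPred_and, Set.ofPred_forall]
    refine IsClosed.inter ?_ (IsClosed.inter ?_ ?_)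
    · exact isClosed_iInter fun v => isClosed_iInter fun u =>
        isClosed_le continuous_const (by fun_prop)
    · exact isClosed_iInter fun v => isClosed_iInter fun u => isClosed_iInter fun _ =>
        isClosed_eq (by fun_prop) continuous_const
    · exact isClosed_iInter fun v => isClosed_eq (by fun_prop) continuous_const
  exact (isCompact_Icc (a := 0) (b := 1)).of_isClosed_subset hclosed fun x hx =>
    ⟨hx.1, le_one_of_mem_fractionalAssignments hx⟩

theorem fractionalAssignments_nonempty {m : P → U} (hm : ∀ v, m v ∈ H v) :
    (fractionalAssignments H).Nonempty := by
  classical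
  refine ⟨fun v => Pi.single (m v) 1, fun v u => ?_, fun v u hu => ?_, fun v => ?_⟩
  · dsimp only
    rw [Pi.single_apply]
    positivity
  · exact Pi.single_eq_of_ne (fun h : u = m v => hu (h ▸ hm v)) 1
  · simp

theorem add_single_mem_fractionalAssignments [DecidableEq U] [DecidableEq P]
    (hx : x ∈ fractionalAssignments H) {v : P} {u u' : U} (hu : u ∈ H v) (hu' : u' ∈ H v) {ε : ℝ}
    (hε : 0 ≤ ε) (hεx : ε ≤ x v u) :
    x + Pi.single v (Pi.single u' ε - Pi.single u ε) ∈ fractionalAssignments H := by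
  refine ⟨fun w t => ?_, fun w t ht => ?_, fun w => ?_⟩
  · rcases eq_or_ne w v with rfl | hw
    · have hadd : 0 ≤ (Pi.single u' ε : U → ℝ) t := by
        rw [Pi.single_apply]
        positivity
      have hsub : (Pi.single u ε : U → ℝ) t ≤ x w t := by
        rcases eq_or_ne t u with rfl | ht
        · simpa using hεx
        · simpa [ht] using hx.1 w t
      simp only [Pi.add_apply, Pi.single_eq_same, Pi.sub_apply]
      linarith
    · simpa [hw] using hx.1 w t
  · rcases eq_or_ne w v with rfl | hw
    · have hne : t ≠ u := fun h => ht (h ▸ hu)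
      have hne' : t ≠ u' := fun h => ht (h ▸ hu')
      simp [hne, hne', hx.2.1 w t ht]
    · simpa [hw] using hx.2.1 w t ht
  · rcases eq_or_ne w v with rfl | hw
    · simp [Finset.sum_add_distrib, hx.2.2 w]
    · simpa [hw] using hx.2.2 w

theorem sum_sq_add_single_sub_single [DecidableEq U] (y : U → ℝ) {u u' : U} (h : u ≠ u') (ε : ℝ) :
    ∑ w, (y + (Pi.single u' ε - Pi.single u ε) : U → ℝ) w ^ 2 =
      ∑ w, y w ^ 2 + 2 * ε * (y u' - y u + ε) := by
  have hterm : ∀ w, (y + (Pi.single u' ε - Pi.single u ε) : U → ℝ) w ^ 2 = y w ^ 2 +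
      ((Pi.single u' (2 * ε * y u' + ε ^ 2) : U → ℝ) w +
        (Pi.single u (ε ^ 2 - 2 * ε * y u) : U → ℝ) w) := fun w => by
    rcases eq_or_ne w u with rfl | hu
    · simp only [Pi.add_apply, Pi.sub_apply, Pi.single_eq_same, Pi.single_eq_of_ne h]
      ring
    · rcases eq_or_ne w u' with rfl | hu'
      · simp only [Pi.add_apply, Pi.sub_apply, Pi.single_eq_same, Pi.single_eq_of_ne hu]
        ring
      · simp [hu, hu']
  simp only [hterm, Finset.sum_add_distrib, Finset.sum_pi_single', Finset.mem_univ, if_true]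
  ring

variable [Fintype P]

theorem sum_load (hx : x ∈ fractionalAssignments H) : ∑ u, load x u = Fintype.card P := by
  simp only [load]
  rw [Finset.sum_comm]
  simp [hx.2.2]

/-- An assignment is balanced if every online node is assigned only to neighbours of least load. -/
def IsBalanced (H : P → Finset U) (x : P → U → ℝ) : Prop :=
  ∀ ⦃v u u'⦄, 0 < x v u → u' ∈ H v → load x u ≤ load x u'

theorem exists_isBalanced (hne : (fractionalAssignments H).Nonempty) :
    ∃ x ∈ fractionalAssignments H, IsBalanced H x := by
  classical
  obtain ⟨x, hx, hmin⟩ := (isCompact_fractionalAssignments H).exists_isMinOn hne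
    (f := fun x => ∑ u, load x u ^ 2) (by fun_prop)
  refine ⟨x, hx, fun v u u' hpos hu' => ?_⟩
  by_contra! hlt
  obtain ⟨ε, hε, hεx, hεgap⟩ : ∃ ε > 0, ε ≤ x v u ∧ ε < load x u - load x u' := by
    obtain ⟨ε, hε, h⟩ := exists_between (lt_min hpos (sub_pos.2 hlt))
    exact ⟨ε, hε, (lt_min_iff.1 h).1.le, (lt_min_iff.1 h).2⟩
  have henergy := hmin (add_single_mem_fractionalAssignments hx
    (mem_of_pos_of_mem_fractionalAssignments hx hpos) hu' hε.le hεx)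
  simp only [Set.mem_ofPred_eq, load_add_single] at henergy
  rw [sum_sq_add_single_sub_single _ (fun h => hlt.ne' (congrArg _ h))] at henergy
  nlinarith

theorem IsBalanced.load_eq_of_pos (hb : IsBalanced H x) (hx : x ∈ fractionalAssignments H) {v : P}
    {u u' : U} (hu : 0 < x v u) (hu' : 0 < x v u') : load x u = load x u' :=
  le_antisymm (hb hu (mem_of_pos_of_mem_fractionalAssignments hx hu'))
    (hb hu' (mem_of_pos_of_mem_fractionalAssignments hx hu))

theorem IsBalanced.eq_zero_of_load_ne (hb : IsBalanced H x) (hx : x ∈ fractionalAssignments H)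
    {v : P} {u u' : U} (hu : 0 < x v u) (hne : load x u ≠ load x u') : x v u' = 0 :=
  ((hx.1 v u').eq_or_lt.resolve_right fun h => hne (hb.load_eq_of_pos hx hu h)).symm

theorem IsBalanced.card_filter_load_eq (hb : IsBalanced H x) (hx : x ∈ fractionalAssignments H)
    {f : P → U} (hf : ∀ v, 0 < x v (f v)) (c : ℝ) :
    ((Finset.univ.filter fun v => load x (f v) = c).card : ℝ) =
      (Finset.univ.filter fun u => load x u = c).card * c := by
  have hrow : ∀ v, ∑ u ∈ Finset.univ.filter (fun u => load x u = c), x v u =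
      if load x (f v) = c then 1 else 0 := fun v => by
    rw [← hx.2.2 v, Finset.sum_filter]
    split_ifs with hv
    · refine Finset.sum_congr rfl fun u _ => ite_eq_left_iff.2 fun hu => ?_
      exact (hb.eq_zero_of_load_ne hx (hf v) fun h => hu (h.symm.trans hv)).symm
    · refine Finset.sum_eq_zero fun u _ => ite_eq_right_iff.2 fun hu => ?_
      exact hb.eq_zero_of_load_ne hx (hf v) fun h => hv (h.trans hu)
  calc ((Finset.univ.filter fun v => load x (f v) = c).card : ℝ)
      = ∑ v, ∑ u ∈ Finset.univ.filter (fun u => load x u = c), x v u := by simp [hrow]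
    _ = ∑ u ∈ Finset.univ.filter (fun u => load x u = c), load x u := Finset.sum_comm
    _ = _ := by
      rw [Finset.sum_congr rfl fun u hu => (Finset.mem_filter.1 hu).2, Finset.sum_const,
        nsmul_eq_mul]

theorem IsBalanced.card_div_card (hb : IsBalanced H x) (hx : x ∈ fractionalAssignments H)
    {f : P → U} (hf : ∀ v, 0 < x v (f v)) (u : U) :
    ((Finset.univ.filter fun v => load x (f v) = load x u).card : ℝ) /
      (Finset.univ.filter fun u' => load x u' = load x u).card = load x u := by
  have hpos : (0 : ℝ) < (Finset.univ.filter fun u' => load x u' = load x u).card :=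
    Nat.cast_pos.2 (Finset.card_pos.2 ⟨u, by simp⟩)
  rw [hb.card_filter_load_eq hx hf, mul_div_cancel_left₀ _ hpos.ne']

theorem IsBalanced.load_le_one (hb : IsBalanced H x) (hx : x ∈ fractionalAssignments H)
    {m : P → U} (hm : Function.Injective m) (hmH : ∀ v, m v ∈ H v) (u : U) : load x u ≤ 1 := by
  choose f hf using exists_pos_of_mem_fractionalAssignments hx
  obtain ⟨u₀, -, hu₀⟩ := Finset.exists_max_image Finset.univ (load x) ⟨u, Finset.mem_univ u⟩
  refine (hu₀ u (Finset.mem_univ u)).trans ?_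
  rw [← hb.card_div_card hx hf u₀]
  refine div_le_one_of_le₀ (Nat.cast_le.2 ?_) (Nat.cast_nonneg _)
  refine Finset.card_le_card_of_injOn m (fun v hv => ?_) hm.injOn
  have hv : load x (f v) = load x u₀ := by simpa using hv
  simpa using (hu₀ (m v) (Finset.mem_univ _)).antisymm (hv.symm.trans_le (hb (hf v) (hmH v)))

theorem IsBalanced.exists_load_lt_and_mem_iff (hb : IsBalanced H x)
    (hx : x ∈ fractionalAssignments H) {f : P → U} (hf : ∀ v, 0 < x v (f v)) (u u' : U) :
    (∃ v, load x u' < load x (f v) ∧ u ∈ H v) ↔ load x u' < load x u := by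
  constructor
  · rintro ⟨v, hv, hu⟩
    exact hv.trans_le (hb (hf v) hu)
  · intro hlt
    have hsum : ∑ _v : P, (0 : ℝ) < ∑ v, x v u := by
      rw [Finset.sum_const_zero]
      exact (Finset.sum_nonneg fun v _ => hx.1 v u').trans_lt hlt
    obtain ⟨v, -, hv⟩ := Finset.exists_lt_of_sum_lt hsum
    exact ⟨v, hlt.trans_eq (hb.load_eq_of_pos hx hv (hf v)),
      mem_of_pos_of_mem_fractionalAssignments hx hv⟩

theorem IsBalanced.sum_sq_load_le (hb : IsBalanced H x) (hx : x ∈ fractionalAssignments H)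
    {m : P → U} (hm : ∀ v, m v ∈ H v) : ∑ u, load x u ^ 2 ≤ ∑ v, load x (m v) := by
  have hterm : ∀ v u, x v u * load x u ≤ x v u * load x (m v) := fun v u => by
    rcases (hx.1 v u).eq_or_lt with h | h
    · rw [← h, zero_mul, zero_mul]
    · exact mul_le_mul_of_nonneg_left (hb h (hm v)) h.le
  calc ∑ u, load x u ^ 2 = ∑ u, ∑ v, x v u * load x u :=
        Finset.sum_congr rfl fun u _ => by rw [sq, ← Finset.sum_mul, load]
    _ = ∑ v, ∑ u, x v u * load x u := Finset.sum_comm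
    _ ≤ ∑ v, ∑ u, x v u * load x (m v) :=
        Finset.sum_le_sum fun v _ => Finset.sum_le_sum fun u _ => hterm v u
    _ = ∑ v, load x (m v) :=
        Finset.sum_congr rfl fun v _ => by rw [← Finset.sum_mul, hx.2.2 v, one_mul]

theorem IsBalanced.card_sq_le (hb : IsBalanced H x) (hx : x ∈ fractionalAssignments H)
    {m : P → U} (hm : ∀ v, m v ∈ H v) :
    (Fintype.card P : ℝ) ^ 2 ≤ Fintype.card U * ∑ v, load x (m v) := by
  rw [← sum_load hx]
  exact (sq_sum_le_card_mul_sum_sq (s := Finset.univ)).trans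
    (mul_le_mul_of_nonneg_left (hb.sum_sq_load_le hx hm) (Nat.cast_nonneg _))

theorem nonempty_matchingSkeleton {H : P → Finset U} (h : matchingNumber H = Fintype.card P) :
    Nonempty (MatchingSkeleton H) := by
  obtain ⟨m, hm, hmH⟩ := exists_injective_of_matchingNumber_eq h
  obtain ⟨x, hx, hb⟩ := exists_isBalanced (fractionalAssignments_nonempty hmH)
  choose f hf using exists_pos_of_mem_fractionalAssignments hx
  obtain ⟨k, t, ht, hle⟩ := exists_antitone_index (load x)
  have hlt : ∀ u u', t u < t u' ↔ load x u' < load x u := fun u u' => by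
    rw [← not_le, hle, not_le]
  have heq : ∀ u u', t u = t u' ↔ load x u = load x u' := fun u u' => by
    rw [le_antisymm_iff, hle, hle, ← le_antisymm_iff, eq_comm]
  have hratio : ∀ u, ((Finset.univ.filter fun v => t (f v) = t u).card : ℝ) /
      (Finset.univ.filter fun u' => t u' = t u).card = load x u := fun u => by
    simpa only [heq] using hb.card_div_card hx hf u
  exact ⟨{
    k := k
    sIndex := t ∘ f
    tIndex := t
    x := x
    tIndex_surjective := ht
    neighbors := fun j u => by
      obtain ⟨u', rfl⟩ := ht j
      simpa only [Function.comp_apply, hlt] using hb.exists_load_lt_and_mem_iff hx hf u u'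
    ratio_strictAnti := fun i j hij => by
      obtain ⟨u, rfl⟩ := ht i
      obtain ⟨u', rfl⟩ := ht j
      simpa only [Function.comp_apply, hratio, hlt] using hij
    fractional := {
      nonneg := hx.1
      le_one := le_one_of_mem_fractionalAssignments hx
      support := hx.2.1
      online_degree_le := fun v => (hx.2.2 v).le
      offline_degree_le := hb.load_le_one hx hm hmH }
    within := fun v u hne => hb.eq_zero_of_load_ne hx (hf v) ((heq _ _).not.1 hne)
    online_degree := hx.2.2
    offline_degree := fun u => (hratio u).symm }⟩

theorem MatchingSkeleton.x_mem_fractionalAssignments (K : MatchingSkeleton H) :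
    K.x ∈ fractionalAssignments H :=
  ⟨K.fractional.nonneg, K.fractional.support, K.online_degree⟩

theorem MatchingSkeleton.isBalanced_x (K : MatchingSkeleton H) : IsBalanced H K.x := by
  intro v u u' hpos hu'
  have hindex : K.sIndex v = K.tIndex u := by_contra fun h => hpos.ne' (K.within v u h)
  have hle : K.tIndex u' ≤ K.tIndex u :=
    not_lt.1 fun h => lt_irrefl _ ((K.neighbors (K.tIndex u') u').1 ⟨v, hindex.trans_lt h, hu'⟩)
  rw [load, load, K.offline_degree, K.offline_degree]
  exact K.ratio_strictAnti.antitone hle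

end Skeleton

section Rounding

theorem exists_doublyStochastic_extension {P U : Type*} [Fintype P] [Fintype U] [DecidableEq U]
    {H : P → Finset U} {x : P → U → ℝ} (hx : x ∈ fractionalAssignments H)
    (hload : ∀ u, load x u ≤ 1) :
    ∃ (e : P ↪ U) (A : Matrix U U ℝ), A ∈ doublyStochastic ℝ U ∧ ∀ v u, A (e v) u = x v u := by
  have hle : Fintype.card P ≤ Fintype.card U := by
    rw [← Nat.cast_le (α := ℝ), ← sum_load hx]
    exact (Finset.sum_le_sum fun u _ => hload u).trans (by simp)
  obtain ⟨r, hr⟩ := Nat.exists_eq_add_of_le hle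
  let e : P ⊕ Fin r ≃ U := Fintype.equivOfCardEq (by simp [hr])
  have hslack : ∑ u, (1 - load x u) = r := by
    rw [Finset.sum_sub_distrib, sum_load hx]
    simp [hr]
  let rows : P ⊕ Fin r → U → ℝ := Sum.elim x fun _ u => (1 - load x u) / r
  refine ⟨Function.Embedding.inl.trans e.toEmbedding, fun a => rows (e.symm a),
    mem_doublyStochastic_iff_sum.2 ⟨fun a u => ?_, fun a => ?_, fun u => ?_⟩, fun v u => ?_⟩
  · rcases e.symm a with v | _
    · exact hx.1 v u
    · exact div_nonneg (sub_nonneg.2 (hload u)) (Nat.cast_nonneg r)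
  · rcases e.symm a with v | j
    · exact hx.2.2 v
    · have hr0 : (r : ℝ) ≠ 0 := Nat.cast_ne_zero.2 (j.pos).ne'
      simp only [rows, Sum.elim_inr, ← Finset.sum_div, hslack, div_self hr0]
  · have hnew : (r : ℝ) * ((1 - load x u) / r) = 1 - load x u := by
      refine mul_div_cancel_of_imp' fun hr0 => ?_
      rw [hr0] at hslack
      exact (Finset.sum_eq_zero_iff_of_nonneg fun u _ => sub_nonneg.2 (hload u)).1 hslack u
        (Finset.mem_univ u)
    rw [Equiv.sum_comp e.symm fun s => rows s u, Fintype.sum_sum_type]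
    simp only [rows, Sum.elim_inl, Sum.elim_inr, Finset.sum_const, Finset.card_univ,
      Fintype.card_fin, nsmul_eq_mul, hnew]
    exact add_sub_cancel _ _
  · simp [rows]

theorem isMatching_image_prodMk {U P : Type*} [DecidableEq U] [DecidableEq P]
    {H : P → Finset U} {m : P → U} (hm : Function.Injective m) {S : Finset P}
    (hmH : ∀ v ∈ S, m v ∈ H v) : IsMatching H (S.image fun v => (v, m v)) := by
  simp only [IsMatching, Finset.forall_mem_image, Prod.mk.injEq]
  exact ⟨hmH, fun v _ w _ h => ⟨h, congrArg m h⟩, fun v _ w _ h => ⟨hm h, h⟩⟩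

variable {U P : Type*} [Fintype U] [Fintype P]

theorem exists_pmf_injective {H : P → Finset U} {x : P → U → ℝ}
    (hx : x ∈ fractionalAssignments H) (hload : ∀ u, load x u ≤ 1) :
    ∃ p : PMF (P → U), (∀ m ∈ p.support, Function.Injective m) ∧
      ∀ v u, p.toOuterMeasure {m | m v = u} = ENNReal.ofReal (x v u) := by
  classical
  obtain ⟨e, A, hA, hAx⟩ := exists_doublyStochastic_extension hx hload
  obtain ⟨w, hw, hwsum, hwA⟩ := exists_eq_sum_perm_of_mem_doublyStochastic hA
  let p : PMF (Equiv.Perm U) := PMF.ofFintype (fun σ => ENNReal.ofReal (w σ)) (by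
    rw [← ENNReal.ofReal_sum_of_nonneg fun σ _ => hw σ, hwsum, ENNReal.ofReal_one])
  refine ⟨p.map fun σ v => σ (e v), fun m hm => ?_, fun v u => ?_⟩
  · obtain ⟨σ, -, rfl⟩ := (PMF.mem_support_map_iff _ _ _).1 hm
    exact σ.injective.comp e.injective
  · have hxw : x v u = ∑ σ : Equiv.Perm U, if σ (e v) = u then w σ else 0 := by
      rw [← hAx, ← hwA, Matrix.sum_apply]
      simp [Equiv.toPEquiv_apply, eq_comm]
    rw [PMF.toOuterMeasure_map_apply, PMF.toOuterMeasure_apply_fintype, hxw,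
      ENNReal.ofReal_sum_of_nonneg fun σ _ => by split_ifs; exacts [hw σ, le_rfl]]
    refine Finset.sum_congr rfl fun σ _ => ?_
    simp only [Set.indicator_apply, Set.mem_preimage, Set.mem_ofPred_eq]
    split_ifs
    · rfl
    · exact ENNReal.ofReal_zero.symm

theorem MatchingSkeleton.exists_isRounding {H : P → Finset U} (K : MatchingSkeleton H) :
    ∃ D : Fin K.k → PMF (Finset (P × U)), ∀ i, K.IsRounding i (D i) := by
  classical
  obtain ⟨p, hinj, hp⟩ := exists_pmf_injective K.x_mem_fractionalAssignments
    K.fractional.offline_degree_le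
  have hne : ∀ m ∈ p.support, ∀ v, K.x v (m v) ≠ 0 := fun m hm v h0 => by
    have hnull := hp v (m v)
    rw [h0, ENNReal.ofReal_zero, PMF.toOuterMeasure_apply_eq_zero_iff] at hnull
    exact Set.disjoint_left.1 hnull hm rfl
  refine ⟨fun i => p.map fun m => (K.S i).image fun v => (v, m v), fun i => ⟨fun M hM => ?_, ?_⟩⟩
  · obtain ⟨m, hm, rfl⟩ := (PMF.mem_support_map_iff _ _ _).1 hM
    have hmem : ∀ v, m v ∈ H v := fun v =>
      by_contra fun h => hne m hm v (K.fractional.support v _ h)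
    have hindex : ∀ v, K.sIndex v = K.tIndex (m v) := fun v =>
      by_contra fun h => hne m hm v (K.within v _ h)
    refine ⟨isMatching_image_prodMk (hinj m hm) fun v _ => hmem v,
      Finset.image_subset_iff.2 fun v hv => ?_,
      Finset.card_image_of_injective _ fun v w h => congrArg Prod.fst h⟩
    simpa [S, T, ← hindex] using hv
  · intro v hv u _
    rw [PMF.toOuterMeasure_map_apply, ← hp v u]
    congr 1
    ext m
    simp [hv]

end Rounding

section Mean

variable {α : Type*} [Fintype α]

/-- The expectation of a real function on a finite probability space, as a linear map. -/
noncomputable def mean (p : PMF α) : (α → ℝ) →ₗ[ℝ] ℝ :=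
  ∑ a, (p a).toReal • LinearMap.proj a

theorem mean_apply (p : PMF α) (f : α → ℝ) : mean p f = ∑ a, (p a).toReal * f a := by
  simp [mean]

theorem mean_const (p : PMF α) (c : ℝ) : (mean p fun _ => c) = c := by
  rw [mean_apply, ← Finset.sum_mul, ← ENNReal.toReal_sum fun a _ => p.apply_ne_top a,
    ← tsum_fintype (L := .unconditional _), p.tsum_coe, ENNReal.toReal_one, one_mul]

theorem mean_mono {p : PMF α} {f g : α → ℝ} (h : ∀ a ∈ p.support, f a ≤ g a) :
    mean p f ≤ mean p g := by
  rw [mean_apply, mean_apply]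
  refine Finset.sum_le_sum fun a _ => ?_
  by_cases ha : a ∈ p.support
  · exact mul_le_mul_of_nonneg_left (h a ha) ENNReal.toReal_nonneg
  · simp [(p.apply_eq_zero_iff a).2 ha]

theorem mean_indicator_one (p : PMF α) (s : Set α) :
    mean p (s.indicator 1) = (p.toOuterMeasure s).toReal := by
  rw [mean_apply, PMF.toOuterMeasure_apply_fintype, ENNReal.toReal_sum]
  · refine Finset.sum_congr rfl fun a _ => ?_
    by_cases ha : a ∈ s <;> simp [ha]
  · intro a _
    by_cases ha : a ∈ s <;> simp [ha, p.apply_ne_top]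

theorem mean_uniformOfFintype [Nonempty α] (f : α → ℝ) :
    mean (PMF.uniformOfFintype α) f = (Fintype.card α : ℝ)⁻¹ * ∑ a, f a := by
  simp [mean_apply, Finset.mul_sum]

end Mean

section ExpectedSize

variable {U : Type*}

theorem OnlineStrategy.size_le_length (σ : OnlineStrategy U) (l : List (Finset U)) :
    σ.size l ≤ l.length :=
  (Finset.card_filter_le _ _).trans_eq (by simp)

theorem expectedSize_eq_toReal (p : PMF (OnlineStrategy U)) (l : List (Finset U)) :
    expectedSize p l = (∑' σ, p σ * (σ.size l : ℝ≥0∞)).toReal := by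
  rw [ENNReal.tsum_toReal_eq fun σ => ENNReal.mul_ne_top (p.apply_ne_top σ) (by simp)]
  simp [expectedSize]

theorem tsum_mul_size_ne_top (p : PMF (OnlineStrategy U)) (l : List (Finset U)) :
    ∑' σ, p σ * (σ.size l : ℝ≥0∞) ≠ ∞ := by
  refine ne_top_of_le_ne_top (b := (l.length : ℝ≥0∞)) (by simp) ?_
  calc ∑' σ, p σ * (σ.size l : ℝ≥0∞) ≤ ∑' σ, p σ * (l.length : ℝ≥0∞) :=
        ENNReal.tsum_le_tsum fun σ => by gcongr; exact_mod_cast σ.size_le_length l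
    _ = l.length := by rw [ENNReal.tsum_mul_right, p.tsum_coe, one_mul]

theorem expectedSize_pure (σ : OnlineStrategy U) (l : List (Finset U)) :
    expectedSize (PMF.pure σ) l = σ.size l := by
  rw [expectedSize, tsum_eq_single σ fun τ hτ => by simp [PMF.pure_apply, hτ]]
  simp

theorem expectedSize_bind {α : Type*} [Fintype α] (p : PMF α) (q : α → PMF (OnlineStrategy U))
    (l : List (Finset U)) : expectedSize (p.bind q) l = mean p fun a => expectedSize (q a) l := by
  have htsum : ∑' σ, (p.bind q) σ * (σ.size l : ℝ≥0∞) =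
      ∑ a, p a * ∑' σ, q a σ * (σ.size l : ℝ≥0∞) := by
    simp only [PMF.bind_apply, ← ENNReal.tsum_mul_right]
    rw [ENNReal.tsum_comm, tsum_fintype]
    simp only [mul_assoc, ENNReal.tsum_mul_left]
  rw [expectedSize_eq_toReal, htsum, ENNReal.toReal_sum fun a _ =>
    ENNReal.mul_ne_top (p.apply_ne_top a) (tsum_mul_size_ne_top (q a) l), mean_apply]
  simp only [ENNReal.toReal_mul, expectedSize_eq_toReal]

theorem expectedSize_map {α : Type*} [Fintype α] (p : PMF α) (F : α → OnlineStrategy U)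
    (l : List (Finset U)) : expectedSize (p.map F) l = mean p fun a => ((F a).size l : ℝ) := by
  rw [← PMF.bind_pure_comp, expectedSize_bind]
  simp only [Function.comp_apply, expectedSize_pure]

theorem ofFn_equiv_perm_toList (A : Finset U) (e : Fin A.card ≃ A) :
    (List.ofFn fun i => (e i : U)).Perm A.toList := by
  refine (List.perm_ext_iff_of_nodup (List.nodup_ofFn.2 (Subtype.val_injective.comp e.injective))
    A.nodup_toList).2 fun a => ?_
  rw [List.mem_ofFn, Finset.mem_toList]
  exact ⟨fun ⟨i, hi⟩ => hi ▸ (e i).2, fun ha => ⟨e.symm ⟨a, ha⟩, by simp⟩⟩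

theorem nodup_permutations' {l : List U} (h : l.Nodup) : l.permutations'.Nodup :=
  (List.permutations_perm_permutations' l).nodup_iff.1 (List.nodup_permutations l h)

variable [DecidableEq U]

theorem sum_ofFn_equiv (A : Finset U) (f : List U → ℝ) :
    ∑ e : Fin A.card ≃ A, f (List.ofFn fun i => (e i : U)) =
      (A.toList.permutations'.map f).sum := by
  have hnodup := nodup_permutations' A.nodup_toList
  have hinj : Function.Injective fun e : Fin A.card ≃ A => List.ofFn fun i => (e i : U) :=
    fun e e' h => Equiv.ext fun i => Subtype.ext (congrFun (List.ofFn_injective h) i)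
  have himage : (Finset.univ.image fun e : Fin A.card ≃ A => List.ofFn fun i => (e i : U)) =
      A.toList.permutations'.toFinset := by
    refine Finset.eq_of_subset_of_card_le (Finset.image_subset_iff.2 fun e _ => ?_) ?_
    · simpa using ofFn_equiv_perm_toList A e
    · rw [Finset.card_image_of_injective _ hinj, List.toFinset_card_of_nodup hnodup,
        length_permutations', Finset.length_toList, Finset.card_univ,
        Fintype.card_equiv A.equivFin.symm, Fintype.card_fin]
  rw [← List.sum_toFinset f hnodup, ← himage, Finset.sum_image hinj.injOn]

theorem expectedSize_map_uniformOrdering (A : Finset U) (F : List U → OnlineStrategy U)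
    (l : List (Finset U)) : expectedSize ((uniformOrdering A).map F) l =
      (A.card.factorial : ℝ)⁻¹ * (A.toList.permutations'.map fun R => ((F R).size l : ℝ)).sum := by
  have : Nonempty (Fin A.card ≃ A) := ⟨A.equivFin.symm⟩
  rw [uniformOrdering, PMF.map_comp, expectedSize_map, mean_uniformOfFintype,
    Fintype.card_equiv A.equivFin.symm, Fintype.card_fin, ← sum_ofFn_equiv]
  rfl

end ExpectedSize

section IndependentLaw

variable {k : ℕ} {α : Type*} [Fintype α] {D : Fin k → PMF α}

theorem mem_support_independentLaw {f : Fin k → α} (hf : f ∈ (independentLaw D).support)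
    (i : Fin k) : f i ∈ (D i).support := by
  rw [independentLaw, PMF.mem_support_ofFintype_iff, Finset.prod_ne_zero_iff] at hf
  exact hf i (Finset.mem_univ i)

theorem map_eval_independentLaw (i : Fin k) : (independentLaw D).map (Function.eval i) = D i := by
  classical
  ext a
  have hmass : ∀ j, ∑ b, D j b = 1 := fun j => by
    rw [← tsum_fintype (L := .unconditional _), (D j).tsum_coe]
  let factor : Fin k → Finset α := Function.update (fun _ => Finset.univ) i {a}
  calc (independentLaw D).map (Function.eval i) a
      = ∑ f : Fin k → α with f i = a, ∏ j, D j (f j) := by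
        rw [PMF.map_apply, tsum_fintype, Finset.sum_filter]
        simp only [independentLaw, PMF.ofFintype_apply, Function.eval, eq_comm]
    _ = ∑ f ∈ Fintype.piFinset factor, ∏ j, D j (f j) := by
        rw [Fintype.piFinset_update_singleton_eq_filter_piFinset_eq _ i (Finset.mem_univ a),
          Fintype.piFinset_univ]
    _ = ∏ j, ∑ b ∈ factor j, D j b := (Finset.prod_univ_sum _ _).symm
    _ = D i a := by
        rw [Finset.prod_eq_single i (fun j _ hj => by simp [factor, hj, hmass]) (by simp)]
        simp [factor]

end IndependentLaw

section SampledMatching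

variable {U P : Type*} {H : P → Finset U}

theorem isMatching_biUnion [DecidableEq U] [DecidableEq P] {ι : Type*} [Fintype ι]
    {M : ι → Finset (P × U)} {s : P → ι} {t : U → ι} (hM : ∀ i, IsMatching H (M i))
    (hst : ∀ i, ∀ e ∈ M i, s e.1 = i ∧ t e.2 = i) :
    IsMatching H (Finset.univ.biUnion M) := by
  simp only [IsMatching, Finset.mem_biUnion, Finset.mem_univ, true_and]
  refine ⟨?_, ?_, ?_⟩
  · rintro e ⟨i, he⟩
    exact (hM i).1 e he
  · rintro e ⟨i, he⟩ f ⟨j, hf⟩ h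
    obtain rfl : i = j := by rw [← (hst i e he).1, ← (hst j f hf).1, h]
    exact (hM i).2.1 e he f hf h
  · rintro e ⟨i, he⟩ f ⟨j, hf⟩ h
    obtain rfl : i = j := by rw [← (hst i e he).2, ← (hst j f hf).2, h]
    exact (hM i).2.2 e he f hf h

variable [Fintype U] [Fintype P] {K : MatchingSkeleton H}
  {D : Fin K.k → PMF (Finset (P × U))}

theorem index_eq_of_mem_support_independentLaw (hD : ∀ i, K.IsRounding i (D i))
    {M : Fin K.k → Finset (P × U)} (hM : M ∈ (independentLaw D).support) (i : Fin K.k) :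
    ∀ e ∈ M i, K.sIndex e.1 = i ∧ K.tIndex e.2 = i := fun e he => by
  have h := ((hD i).1 _ (mem_support_independentLaw hM i)).2.1 he
  simpa [MatchingSkeleton.S, MatchingSkeleton.T] using h

variable [DecidableEq U] [DecidableEq P]

theorem exists_mem_biUnion_of_mem_support (hD : ∀ i, K.IsRounding i (D i))
    {M : Fin K.k → Finset (P × U)} (hM : M ∈ (independentLaw D).support) (v : P) :
    ∃ u, (v, u) ∈ Finset.univ.biUnion M := by
  obtain ⟨hmatching, hsub, hcard⟩ :=
    (hD (K.sIndex v)).1 _ (mem_support_independentLaw hM (K.sIndex v))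
  obtain ⟨u, hu⟩ := hmatching.exists_mem (fun e he => (Finset.mem_product.1 (hsub he)).1) hcard
    (v := v) (by simp [MatchingSkeleton.S])
  exact ⟨u, Finset.mem_biUnion.2 ⟨_, Finset.mem_univ _, hu⟩⟩

theorem prob_mem_biUnion_le (hD : ∀ i, K.IsRounding i (D i)) (v : P) (u : U) :
    (independentLaw D).toOuterMeasure {M | (v, u) ∈ Finset.univ.biUnion M} ≤
      ENNReal.ofReal (K.x v u) := by
  by_cases h : K.tIndex u = K.sIndex v
  · rw [← (hD (K.sIndex v)).2 v (by simp [MatchingSkeleton.S]) u (by simp [MatchingSkeleton.T, h]),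
      ← map_eval_independentLaw (D := D), PMF.toOuterMeasure_map_apply]
    refine PMF.toOuterMeasure_mono _ fun M hM => ?_
    obtain ⟨i, -, hi⟩ := Finset.mem_biUnion.1 hM.1
    obtain rfl := (index_eq_of_mem_support_independentLaw hD hM.2 i _ hi).1
    exact hi
  · refine le_of_eq_of_le ?_ zero_le
    rw [PMF.toOuterMeasure_apply_eq_zero_iff, Set.disjoint_left]
    intro M hM hmem
    obtain ⟨i, -, hi⟩ := Finset.mem_biUnion.1 hmem
    obtain ⟨hs, ht⟩ := index_eq_of_mem_support_independentLaw hD hM i _ hi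
    exact h (ht.trans hs.symm)

theorem one_sub_load_le_mean_reserved (hD : ∀ i, K.IsRounding i (D i)) (u : U) :
    1 - load K.x u ≤
      mean (independentLaw D) ({M | u ∈ reserved (Finset.univ.biUnion M)}.indicator 1) := by
  let matched (v : P) : Set (Fin K.k → Finset (P × U)) := {M | (v, u) ∈ Finset.univ.biUnion M}
  have hprob : ∀ v, mean (independentLaw D) ((matched v).indicator 1) ≤ K.x v u := fun v => by
    rw [mean_indicator_one]
    exact ENNReal.toReal_le_of_le_ofReal (K.fractional.nonneg v u) (prob_mem_biUnion_le hD v u)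
  calc 1 - load K.x u
      ≤ 1 - ∑ v, mean (independentLaw D) ((matched v).indicator 1) :=
        sub_le_sub_left (Finset.sum_le_sum fun v _ => hprob v) 1
    _ = mean (independentLaw D) ((fun _ => 1) - ∑ v, (matched v).indicator 1) := by
        rw [map_sub, map_sum, mean_const]
    _ ≤ _ := mean_mono fun M _ => ?_
  have hnonneg : ∀ v, 0 ≤ (matched v).indicator (1 : (Fin K.k → Finset (P × U)) → ℝ) M := fun v =>
    Set.indicator_nonneg (fun _ _ => zero_le_one) M
  rw [Pi.sub_apply, Finset.sum_apply]
  by_cases hu : u ∈ reserved (Finset.univ.biUnion M)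
  · rw [Set.indicator_of_mem (by exact hu), Pi.one_apply]
    exact sub_le_self _ (Finset.sum_nonneg fun v _ => hnonneg v)
  · obtain ⟨v, hv⟩ : ∃ v, (v, u) ∈ Finset.univ.biUnion M := by simpa [reserved] using hu
    have hone : (matched v).indicator (1 : (Fin K.k → Finset (P × U)) → ℝ) M = 1 :=
      Set.indicator_of_mem hv 1
    rw [Set.indicator_of_notMem (by exact hu), sub_nonpos, ← hone]
    exact Finset.single_le_sum (fun w _ => hnonneg w) (Finset.mem_univ v)

theorem feasible_of_mem_support_structuredSampling (hD : ∀ i, K.IsRounding i (D i))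
    {σ : OnlineStrategy U} (hσ : σ ∈ (structuredSampling K D).support) : σ.Feasible := by
  obtain ⟨M, hM, hσ⟩ := (PMF.mem_support_bind_iff _ _ _).1 hσ
  obtain ⟨R, hR, rfl⟩ := (PMF.mem_support_map_iff _ _ _).1 hσ
  obtain ⟨e, -, rfl⟩ := (PMF.mem_support_map_iff _ _ _).1 hR
  refine feasible_onlinePhase (isMatching_biUnion
    (fun i => ((hD i).1 _ (mem_support_independentLaw hM i)).1)
    (index_eq_of_mem_support_independentLaw hD hM)) fun u hu => ?_
  obtain ⟨i, rfl⟩ := List.mem_ofFn.1 hu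
  exact (Finset.mem_filter.1 (e i).2).2

variable {V : Type*} {G : V → Finset U} {VA W : Finset V} {mate : V → U}
  {l : List (Finset U)}

theorem le_expectedSize_map_onlinePhase {M : Finset (P × U)} (hW : W ⊆ VA)
    (hl : (l : Multiset (Finset U)) = (Finset.univ : Finset P).val.map H + VA.val.map G)
    (hM : ∀ v, ∃ u, (v, u) ∈ M) (hmate : Set.InjOn mate W) (hG : ∀ v ∈ W, mate v ∈ G v)
    (hmem : ∀ v ∈ W, mate v ∈ reserved M) :
    Fintype.card P + (1 - 1 / Real.exp 1) * W.card ≤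
      expectedSize ((uniformOrdering (reserved M)).map fun R => onlinePhase H M R) l := by
  rw [expectedSize_map_uniformOrdering, le_inv_mul_iff₀ (by positivity),
    ← Finset.length_toList (reserved M)]
  exact le_sum_permutations'_size_onlinePhase hW hl hM (Finset.nodup_toList _)
    (fun u hu => by simpa [reserved] using hu) hmate hG fun v hv => by simpa using hmem v hv

theorem le_expectedSize_structuredSampling (hD : ∀ i, K.IsRounding i (D i)) (hW : W ⊆ VA)
    (hl : (l : Multiset (Finset U)) = (Finset.univ : Finset P).val.map H + VA.val.map G)
    (hmate : Set.InjOn mate W) (hG : ∀ v ∈ W, mate v ∈ G v) :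
    Fintype.card P + (1 - 1 / Real.exp 1) * ∑ v ∈ W, (1 - load K.x (mate v)) ≤
      expectedSize (structuredSampling K D) l := by
  let free (v : V) : Set (Fin K.k → Finset (P × U)) :=
    {M | mate v ∈ reserved (Finset.univ.biUnion M)}
  have hcoef := one_sub_one_div_exp_one_nonneg
  calc Fintype.card P + (1 - 1 / Real.exp 1) * ∑ v ∈ W, (1 - load K.x (mate v))
      ≤ Fintype.card P + (1 - 1 / Real.exp 1) *
          ∑ v ∈ W, mean (independentLaw D) ((free v).indicator 1) := by
        gcongr with v
        exact one_sub_load_le_mean_reserved hD (mate v)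
    _ = mean (independentLaw D) ((fun _ => (Fintype.card P : ℝ)) +
          (1 - 1 / Real.exp 1) • ∑ v ∈ W, (free v).indicator 1) := by
        rw [map_add, map_smul, map_sum, mean_const, smul_eq_mul]
    _ ≤ expectedSize (structuredSampling K D) l := by
        rw [structuredSampling, expectedSize_bind]
        refine mean_mono fun M hM => ?_
        have hfixed := le_expectedSize_map_onlinePhase
          (W := W.filter fun v => mate v ∈ reserved (Finset.univ.biUnion M))
          ((Finset.filter_subset _ _).trans hW) hl (exists_mem_biUnion_of_mem_support hD hM)
          (hmate.mono (Finset.coe_subset.2 (Finset.filter_subset _ _)))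
          (fun v hv => hG v (Finset.mem_filter.1 hv).1)
          fun v hv => (Finset.mem_filter.1 hv).2
        convert hfixed using 1
        simp [free, Set.indicator_apply]

end SampledMatching

section PerfectMatching

variable {U V : Type*}

theorem HasPerfectMatching.exists_bijective {G : V → Finset U} (h : HasPerfectMatching G) :
    ∃ m : V → U, Function.Bijective m ∧ ∀ v, m v ∈ G v := by
  obtain ⟨M, hM, hV, hU⟩ := h
  choose m hm using hV
  refine ⟨m, ⟨fun v w hvw => congrArg Prod.fst (hM.2.2 _ (hm v) _ (hm w) hvw), fun u => ?_⟩,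
    fun v => hM.1 _ (hm v)⟩
  obtain ⟨v, hv⟩ := hU u
  exact ⟨v, congrArg Prod.snd (hM.2.1 _ (hm v) _ hv rfl)⟩

theorem matchingNumber_eq_card [Fintype U] [Fintype V] {G : V → Finset U} {m : V → U}
    (hm : Function.Injective m) (hG : ∀ v, m v ∈ G v) : matchingNumber G = Fintype.card V := by
  classical
  refine le_antisymm (Finset.sup_le fun M hM => ?_) ?_
  · exact Finset.card_le_card_of_injOn Prod.fst (fun _ _ => Finset.mem_univ _)
      (Finset.mem_filter.1 hM).2.2.1
  · rw [← Finset.card_univ, ← Finset.card_image_of_injective Finset.univ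
      (f := fun v => (v, m v)) fun v w h => congrArg Prod.fst h]
    exact Finset.le_sup (f := Finset.card)
      (Finset.mem_filter.2 ⟨Finset.mem_univ _, isMatching_image_prodMk hm fun v _ => hG v⟩)

variable [DecidableEq V]

theorem coe_ofFn_order_eq_add [Fintype V] {α : Type*} (f : V → α) (S : Finset V)
    (order : Fin (Fintype.card V) ≃ V) :
    ((List.ofFn fun i => f (order i) : List α) : Multiset α) =
      (Finset.univ : Finset {v // v ∈ S}).val.map (fun v : {v // v ∈ S} => f v) + Sᶜ.val.map f := by
  have hS : (Finset.univ : Finset {v // v ∈ S}).val.map Subtype.val = S.val :=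
    congrArg Finset.val S.attach_map_val
  calc ((List.ofFn fun i => f (order i) : List α) : Multiset α)
      = (Finset.univ : Finset V).val.map f := by
        rw [← Fin.univ_val_map, ← Finset.map_univ_equiv order, Finset.map_val, Multiset.map_map]
        rfl
    _ = S.val.map f + Sᶜ.val.map f := by
        rw [← Finset.union_compl S, ← Finset.disjUnion_eq_union _ _ disjoint_compl_right,
          Finset.disjUnion_val, Multiset.map_add]
    _ = _ := by rw [← hS, Multiset.map_map]; rfl

theorem IsBalanced.le_sum_one_sub_load [Fintype U] {G : V → Finset U} {S W : Finset V}
    {x : {v // v ∈ S} → U → ℝ} (hb : IsBalanced (fun v : {v // v ∈ S} => G v) x)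
    (hx : x ∈ fractionalAssignments fun v : {v // v ∈ S} => G v) (hSW : S ⊆ W) {m : V → U}
    (hm : Set.InjOn m W) (hmG : ∀ v ∈ W, m v ∈ G v) :
    (W.card - 2 * S.card + S.card ^ 2 / Fintype.card U : ℝ) ≤
      ∑ v ∈ W \ S, (1 - load x (m v)) := by
  classical
  have hload : ∑ v ∈ W \ S, load x (m v) + ∑ v ∈ S, load x (m v) ≤ S.card := by
    calc ∑ v ∈ W \ S, load x (m v) + ∑ v ∈ S, load x (m v)
        = ∑ u ∈ W.image m, load x u := by rw [Finset.sum_sdiff hSW, Finset.sum_image hm]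
      _ ≤ ∑ u, load x u := Finset.sum_le_univ_sum_of_nonneg fun u =>
          Finset.sum_nonneg fun v _ => hx.1 v u
      _ = S.card := by rw [sum_load hx, Fintype.card_coe]
  have hsquare : (S.card : ℝ) ^ 2 / Fintype.card U ≤ ∑ v ∈ S, load x (m v) := by
    have h := hb.card_sq_le hx (m := fun v => m v) fun v => hmG v (hSW v.2)
    rw [Fintype.card_coe, Finset.sum_coe_sort S fun v => load x (m v)] at h
    exact div_le_of_le_mul₀ (Nat.cast_nonneg _)
      (Finset.sum_nonneg fun v _ => Finset.sum_nonneg fun w _ => hx.1 w (m v)) (by linarith)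
  have hcard : ((W \ S).card : ℝ) = W.card - S.card := Finset.cast_card_sdiff hSW
  rw [Finset.sum_sub_distrib, Finset.sum_const, nsmul_one, hcard]
  linarith

end PerfectMatching

section Guarantee

/-- The expected size of the matching is at least `β p w n` whenever `G` has `n` offline nodes, `p`
of its online nodes are predicted, and the predicted nodes are among `w` online nodes that can be
matched simultaneously. -/
def SemiOnlineAlgorithm.GuaranteesSize (alg : SemiOnlineAlgorithm.{u})
    (β : ℝ → ℝ → ℝ → ℝ) : Prop :=
  ∀ (U V : Type u) [Fintype U] [DecidableEq U] [Fintype V] [DecidableEq V] (G : V → Finset U)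
    (VP W : Finset V) (order : Fin (Fintype.card V) ≃ V) (m : V → U),
    VP ⊆ W → Set.InjOn m W → (∀ v ∈ W, m v ∈ G v) →
    β VP.card W.card (Fintype.card U) ≤
      expectedSize (alg.law U {v // v ∈ VP} fun v => G v.1) (List.ofFn fun i => G (order i))

theorem SemiOnlineAlgorithm.GuaranteesSize.isCompetitive {alg : SemiOnlineAlgorithm.{u}} {c : ℝ}
    (h : alg.GuaranteesSize fun p w n => p + c * (w - 2 * p + p ^ 2 / n)) :
    alg.IsCompetitive fun δ => 1 - δ + δ ^ 2 * c := by
  intro U V _ _ _ _ G VP order hG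
  obtain ⟨m, hm, hmG⟩ := hG.exists_bijective
  have hsize := h U V G VP Finset.univ order m (Finset.subset_univ _) hm.1.injOn fun v _ => hmG v
  have hcompl : (VPᶜ.card : ℝ) = Fintype.card V - VP.card := by
    rw [Finset.card_compl, Nat.cast_sub (Finset.card_le_univ _)]
  refine le_of_eq_of_le ?_ hsize
  simp only [matchingNumber_eq_card hm.1 hmG, hcompl, Finset.card_univ,
    ← Fintype.card_of_bijective hm]
  rcases isEmpty_or_nonempty V with _ | _
  · simp [Finset.eq_empty_of_isEmpty VP]
  · field_simp
    ring

theorem exists_isStructuredSampling :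
    ∃ alg : SemiOnlineAlgorithm.{u}, alg.IsStructuredSampling := by
  classical
  let law (U P : Type u) [Fintype U] [DecidableEq U] [Fintype P] [DecidableEq P]
      (H : P → Finset U) : PMF (OnlineStrategy U) :=
    if h : ∃ (K : MatchingSkeleton H) (D : Fin K.k → PMF (Finset (P × U))),
        ∀ i, K.IsRounding i (D i)
    then structuredSampling h.choose h.choose_spec.choose
    else PMF.pure fun _ _ => none
  refine ⟨⟨law, fun U P _ _ _ _ H σ hσ => ?_⟩, fun U P _ _ _ _ H hH => ?_⟩
  · by_cases h : ∃ (K : MatchingSkeleton H) (D : Fin K.k → PMF (Finset (P × U))),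
        ∀ i, K.IsRounding i (D i)
    · simp only [law, dif_pos h] at hσ
      exact feasible_of_mem_support_structuredSampling h.choose_spec.choose_spec hσ
    · simp only [law, dif_neg h] at hσ
      obtain rfl := (PMF.mem_support_pure_iff _ _).1 hσ
      exact fun l i u hu => nomatch hu
  · obtain ⟨K⟩ := nonempty_matchingSkeleton hH
    have h : ∃ (K : MatchingSkeleton H) (D : Fin K.k → PMF (Finset (P × U))),
        ∀ i, K.IsRounding i (D i) := ⟨K, K.exists_isRounding⟩
    exact ⟨h.choose, h.choose_spec.choose, h.choose_spec.choose_spec, dif_pos h⟩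

theorem SemiOnlineAlgorithm.IsStructuredSampling.guaranteesSize {alg : SemiOnlineAlgorithm.{u}}
    (halg : alg.IsStructuredSampling) :
    alg.GuaranteesSize fun p w n => p + (1 - 1 / Real.exp 1) * (w - 2 * p + p ^ 2 / n) := by
  intro U V _ _ _ _ G VP W order m hVP hm hmG
  obtain ⟨K, D, hD, hlaw⟩ := halg U {v // v ∈ VP} (fun v => G v.1)
    (matchingNumber_eq_card ((hm.mono (Finset.coe_subset.2 hVP)).injective)
      fun v => hmG v.1 (hVP v.2))
  have hcoef := one_sub_one_div_exp_one_nonneg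
  rw [hlaw]
  calc (VP.card + (1 - 1 / Real.exp 1) * (W.card - 2 * VP.card + VP.card ^ 2 / Fintype.card U) : ℝ)
      ≤ VP.card + (1 - 1 / Real.exp 1) * ∑ v ∈ W \ VP, (1 - load K.x (m v)) := by
        gcongr
        exact K.isBalanced_x.le_sum_one_sub_load K.x_mem_fractionalAssignments hVP hm hmG
    _ ≤ expectedSize (structuredSampling K D) (List.ofFn fun i => G (order i)) := by
        rw [← Fintype.card_coe VP]
        exact le_expectedSize_structuredSampling hD
          (fun v hv => Finset.mem_compl.2 (Finset.mem_sdiff.1 hv).2)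
          (coe_ofFn_order_eq_add G VP order)
          (hm.mono (Finset.coe_subset.2 Finset.sdiff_subset))
          fun v hv => hmG v (Finset.mem_sdiff.1 hv).1

end Guarantee

end SemiOnline

theorem mainTheorem1_general :
    (∃ alg : SemiOnline.SemiOnlineAlgorithm.{u}, alg.IsStructuredSampling) ∧
    ∀ alg : SemiOnline.SemiOnlineAlgorithm.{u}, alg.IsStructuredSampling →
      alg.GuaranteesSize fun p w n => p + (1 - 1 / Real.exp 1) * (w - 2 * p + p ^ 2 / n) :=
  ⟨SemiOnline.exists_isStructuredSampling, fun _ h => h.guaranteesSize⟩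

theorem mainTheorem1 :
    (∃ alg : SemiOnline.SemiOnlineAlgorithm.{u}, alg.IsStructuredSampling) ∧
    ∀ alg : SemiOnline.SemiOnlineAlgorithm.{u}, alg.IsStructuredSampling →
      alg.IsCompetitive fun δ => 1 - δ + δ ^ 2 * (1 - 1 / Real.exp 1) :=
  ⟨mainTheorem1_general.1, fun alg h => (mainTheorem1_general.2 alg h).isCompetitive⟩
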